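/- Let $d\ge 3$. Let $V:\mathbb R^d\to\mathbb R$ be smooth and exponentially decaying, and let $f:[0,\infty)\to\mathbb R$ be smooth with $f(\tau)=O(\tau)$ as $\tau\to0$. Let $I\subset\mathbb R$ be an open interval and $(\phi^\lambda)_{\lambda\in I}$ a branch of nonlinear ground states: for each $\lambda\in I$, $\phi^\lambda\in C^2(\mathbb R^d)\cap H^1(\mathbb R^d)$ is bounded, $\phi^\lambda>0$, and $$-\Delta\phi^\lambda+V\phi^\lambda-f\big((\phi^\lambda)^2\big)\phi^\lambda=-\lambda\phi^\lambda ;$$ moreover $(\lambda,x)\mapsto\phi^\lambda(x)$ is $C^1$ on $I\times\mathbb R^d$ and $\partial_\lambda\phi^\lambda\in L^2(\mathbb R^d)$ for each $\lambda\in I$. Put $$L_-(\lambda)=-\Delta+\lambda+V-f\big((\phi^\lambda)^2\big),\qquad L_+(\lambda)=L_-(\lambda)-2f'\big((\phi^\lambda)^2\big)(\phi^\lambda)^2,$$ $$L(\lambda)=\begin{pmatrix}0&L_-(\lambda)\\-L_+(\lambda)&0\end{pmatrix}\quad\text{on } H^2(\mathbb R^d,\mathbb C)\oplus H^2(\mathbb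 R^d,\mathbb C)\subset L^2\oplus L^2 .$$ Fix $\lambda\in I$ and suppose that, for some $E(\lambda)>0$ and some $N$, the vectors $v_1,\dots,v_N$ form a (complex) basis of the eigenspace $\{u: L(\lambda)u=iE(\lambda)u\}$. Then there exist real-valued functions $\xi_n,\eta_n\in L^2(\mathbb R^d)$, $n=1,\dots,N$, such that the vectors $\begin{pmatrix}\xi_n\\ i\eta_n\end{pmatrix}$, $n=1,\dots,N$, are linearly independent over $\mathbb C$ and $$\operatorname{span}_{\mathbb C}\Big\{\begin{pmatrix}\xi_n\\ i\eta_n\end{pmatrix}: 1\le n\le N\Big\}=\operatorname{span}_{\mathbb C}\{v_1,\dots,v_N\},$$ and such that for all $m,n\in\{1,\dots,N\}$ the function $f'\big((\phi^\lambda)^2\big)(\phi^\lambda)^2(\xi_m\eta_n-\xi_n\eta_m)$ is integrable and $$\int_{\mathbb R^d} f'\big((\phi^\lambda)^2\big)(\phi^\lambda)^2(\xi_m\eta_n-\xi_n\eta_m)\,dx=0,$$ $$\langle\phi^\lambda,\xi_n\rangle=\langle\partial_\lambda\phi^\lambda,\eta_n\rangle=0,\qquad \langle\xi_n,\eta_m\rangle=\delta_{m,n},$$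 where $\langle g,h\rangle=\int_{\mathbb R^d} g\,\overline{h}\,dx$. -/

import Mathlib

open MeasureTheory Set Filter Topology
open scoped ENNReal SchwartzMap ContDiff Laplacian

namespace NLS

noncomputable section

/-- The space `ℝ^d` with its Euclidean norm. -/
abbrev Space (d : ℕ) := EuclideanSpace ℝ (Fin d)

/-- The complex Hilbert space `L²(ℝ^d, ℂ)`. -/
abbrev L2 (d : ℕ) := Lp ℂ 2 (volume : Measure (Space d))

/-- The Sobolev space `H²(ℝ^d, ℂ)` as a subspace of `L²(ℝ^d, ℂ)`. -/
def H2 (d : ℕ) : Submodule ℂ (L2 d) where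
  carrier := {u | TemperedDistribution.MemSobolev 2 2 (u : 𝓢'(Space d, ℂ))}
  add_mem' {u w} hu hw := by
    have h := TemperedDistribution.MemSobolev.add hu hw
    rw [← Lp.toTemperedDistributionCLM_apply, ← Lp.toTemperedDistributionCLM_apply, ← map_add] at h
    exact h
  zero_mem' := by
    have h := TemperedDistribution.memSobolev_fun_zero (Space d) ℂ 2 2
    rw [← map_zero (Lp.toTemperedDistributionCLM ℂ (volume : Measure (Space d)) 2)] at h
    exact h
  smul_mem' c u hu := by
    have h := TemperedDistribution.MemSobolev.smul c hu
    rw [← Lp.toTemperedDistributionCLM_apply, ← map_smul] at h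
    exact h

theorem toTemperedDistribution_injective {d : ℕ} :
    Function.Injective (fun u : L2 d => (u : 𝓢'(Space d, ℂ))) := by
  intro u w h
  exact LinearMap.ker_eq_bot.mp (Lp.ker_toTemperedDistributionCLM_eq_bot
    (F := ℂ) (μ := (volume : Measure (Space d))) (p := 2)) h

theorem exists_laplacian {d : ℕ} (u : H2 d) :
    ∃ g : L2 d, (g : 𝓢'(Space d, ℂ)) = Δ ((u : L2 d) : 𝓢'(Space d, ℂ)) := by
  have h := TemperedDistribution.MemSobolev.laplacian u.2
  rw [sub_self, TemperedDistribution.memSobolev_zero_iff] at h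
  obtain ⟨g, hg⟩ := h
  exact ⟨g, hg.symm⟩

/-- The distributional Laplacian as a linear map `H²(ℝ^d, ℂ) → L²(ℝ^d, ℂ)`. -/
def laplacianH2 (d : ℕ) : H2 d →ₗ[ℂ] L2 d where
  toFun u := (exists_laplacian u).choose
  map_add' u w := by
    apply toTemperedDistribution_injective
    change ((exists_laplacian (u + w)).choose : 𝓢'(Space d, ℂ)) = Lp.toTemperedDistributionCLM ℂ
      (volume : Measure (Space d)) 2 ((exists_laplacian u).choose + (exists_laplacian w).choose)
    rw [(exists_laplacian (u + w)).choose_spec, map_add, Lp.toTemperedDistributionCLM_apply,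
      Lp.toTemperedDistributionCLM_apply, (exists_laplacian u).choose_spec,
      (exists_laplacian w).choose_spec, Submodule.coe_add, ← Lp.toTemperedDistributionCLM_apply,
      map_add, ← TemperedDistribution.laplacianCLM_apply, map_add]
    simp
  map_smul' c u := by
    apply toTemperedDistribution_injective
    change ((exists_laplacian (c • u)).choose : 𝓢'(Space d, ℂ)) = Lp.toTemperedDistributionCLM ℂ
      (volume : Measure (Space d)) 2 (c • (exists_laplacian u).choose)
    rw [(exists_laplacian (c • u)).choose_spec, map_smul, Lp.toTemperedDistributionCLM_apply,
      (exists_laplacian u).choose_spec, Submodule.coe_smul, ← Lp.toTemperedDistributionCLM_apply,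
      map_smul, ← TemperedDistribution.laplacianCLM_apply, map_smul]
    simp

theorem laplacianH2_spec {d : ℕ} (u : H2 d) :
    (laplacianH2 d u : 𝓢'(Space d, ℂ)) = Δ ((u : L2 d) : 𝓢'(Space d, ℂ)) :=
  (exists_laplacian u).choose_spec

/-- The domain `{u ∈ L² : W u ∈ L²}` of multiplication by a real function `W` (this is all of `L²`
when `W` is bounded and measurable). -/
def multDomain {d : ℕ} (W : Space d → ℝ) : Submodule ℂ (L2 d) where
  carrier := {u | MemLp (fun x => (W x : ℂ) * u x) 2 volume}
  add_mem' {u w} hu hw := by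
    refine (memLp_congr_ae ?_).mp (MemLp.add hu hw)
    filter_upwards [Lp.coeFn_add u w] with x hx
    rw [hx, Pi.add_apply, Pi.add_apply, mul_add]
  zero_mem' := by
    refine (memLp_congr_ae ?_).mp (MemLp.zero (ε := ℂ) (p := 2))
    filter_upwards [Lp.coeFn_zero ℂ 2 (volume : Measure (Space d))] with x hx
    rw [hx, Pi.zero_apply, mul_zero]
  smul_mem' c u hu := by
    refine (memLp_congr_ae ?_).mp (MemLp.const_mul hu c)
    filter_upwards [Lp.coeFn_smul c u] with x hx
    rw [hx, Pi.smul_apply, smul_eq_mul, mul_left_comm]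

/-- Multiplication by the real function `W`. -/
def mult {d : ℕ} (W : Space d → ℝ) : multDomain W →ₗ[ℂ] L2 d where
  toFun u := MemLp.toLp (fun x => (W x : ℂ) * (u : L2 d) x) u.2
  map_add' u w := by
    apply Lp.ext
    refine (MemLp.coeFn_toLp _).trans ?_
    filter_upwards [Lp.coeFn_add (u : L2 d) (w : L2 d), MemLp.coeFn_toLp u.2, MemLp.coeFn_toLp w.2,
      Lp.coeFn_add (MemLp.toLp _ u.2) (MemLp.toLp _ w.2)] with x h₁ h₂ h₃ h₄
    rw [h₄, Pi.add_apply, h₂, h₃, Submodule.coe_add, h₁, Pi.add_apply, mul_add]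
  map_smul' c u := by
    apply Lp.ext
    refine (MemLp.coeFn_toLp _).trans ?_
    filter_upwards [Lp.coeFn_smul c (u : L2 d), MemLp.coeFn_toLp u.2,
      Lp.coeFn_smul c (MemLp.toLp _ u.2)] with x h₁ h₂ h₃
    rw [RingHom.id_apply, h₃, Pi.smul_apply, h₂, Submodule.coe_smul, h₁, Pi.smul_apply,
      smul_eq_mul, smul_eq_mul, mul_left_comm]

/-- The Schrödinger operator `-Δ + W` as an unbounded operator in `L²(ℝ^d, ℂ)`. Its domain consists
of the `u ∈ H²` with `W u ∈ L²`, which is all of `H²` when `W` is bounded and measurable. -/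
def schrodinger {d : ℕ} (W : Space d → ℝ) : L2 d →ₗ.[ℂ] L2 d where
  domain := H2 d ⊓ multDomain W
  toFun := -laplacianH2 d ∘ₗ Submodule.inclusion inf_le_left +
    mult W ∘ₗ Submodule.inclusion inf_le_right

/-- `L₋ = -Δ + lam + V - f(φ²)`. -/
def Lminus {d : ℕ} (V : Space d → ℝ) (f : ℝ → ℝ) (lam : ℝ) (φ : Space d → ℝ) : L2 d →ₗ.[ℂ] L2 d :=
  schrodinger fun x => lam + V x - f (φ x ^ 2)

/-- `L₊ = -Δ + lam + V - f(φ²) - 2 f'(φ²) φ²`. -/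
def Lplus {d : ℕ} (V : Space d → ℝ) (f : ℝ → ℝ) (lam : ℝ) (φ : Space d → ℝ) : L2 d →ₗ.[ℂ] L2 d :=
  schrodinger fun x => lam + V x - f (φ x ^ 2) - 2 * deriv f (φ x ^ 2) * φ x ^ 2

/-- The block diagonal operator with entries `A` and `B`. -/
def blockDiag {d : ℕ} (A B : L2 d →ₗ.[ℂ] L2 d) : L2 d × L2 d →ₗ.[ℂ] L2 d × L2 d where
  domain := A.domain.prod B.domain
  toFun :=
    { toFun := fun u => (A ⟨u.1.1, u.2.1⟩, B ⟨u.1.2, u.2.2⟩)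
      map_add' := fun u w => Prod.ext
        (A.map_add ⟨u.1.1, u.2.1⟩ ⟨w.1.1, w.2.1⟩) (B.map_add ⟨u.1.2, u.2.2⟩ ⟨w.1.2, w.2.2⟩)
      map_smul' := fun c u => Prod.ext
        (A.map_smul c ⟨u.1.1, u.2.1⟩) (B.map_smul c ⟨u.1.2, u.2.2⟩) }

/-- The symplectic matrix `J = [[0, 1], [-1, 0]]`. -/
def J (d : ℕ) : L2 d × L2 d →ₗ[ℂ] L2 d × L2 d :=
  (LinearMap.snd ℂ (L2 d) (L2 d)).prod (-LinearMap.fst ℂ (L2 d) (L2 d))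

/-- The linearized operator `L(lam) = J H(lam)`, `H(lam) = diag(L₊, L₋)`, about the bound
state `φ`. -/
def linearizedOperator {d : ℕ} (V : Space d → ℝ) (f : ℝ → ℝ) (lam : ℝ) (φ : Space d → ℝ) :
    L2 d × L2 d →ₗ.[ℂ] L2 d × L2 d :=
  (J d).compPMap (blockDiag (Lplus V f lam φ) (Lminus V f lam φ))

/-- The eigenspace `{u ∈ D(T) : T u = μ u}` of an unbounded operator `T`. -/
def eigenspace {X : Type*} [AddCommGroup X] [Module ℂ X] (T : X →ₗ.[ℂ] X) (μ : ℂ) :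
    Submodule ℂ X where
  carrier := {u | ∃ h : u ∈ T.domain, T ⟨u, h⟩ = μ • u}
  add_mem' := by
    rintro u w ⟨hu, eu⟩ ⟨hw, ew⟩
    refine ⟨T.domain.add_mem hu hw, ?_⟩
    rw [smul_add, ← eu, ← ew]
    exact T.map_add ⟨u, hu⟩ ⟨w, hw⟩
  zero_mem' := ⟨T.domain.zero_mem, by rw [smul_zero]; exact T.map_zero⟩
  smul_mem' := by
    rintro c u ⟨hu, eu⟩
    refine ⟨T.domain.smul_mem c hu, ?_⟩
    rw [smul_comm, ← eu]
    exact T.map_smul c ⟨u, hu⟩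

/-- A real `L²` function regarded as a complex one. -/
def toComplex {d : ℕ} (u : Lp ℝ 2 (volume : Measure (Space d))) : L2 d :=
  Complex.ofRealCLM.compLp u

/-- `V` is smooth and decays exponentially at infinity. -/
structure IsAdmissiblePotential {d : ℕ} (V : Space d → ℝ) : Prop where
  smooth : ContDiff ℝ ∞ V
  decay : ∃ C a : ℝ, 0 < a ∧ ∀ x, |V x| ≤ C * Real.exp (-a * ‖x‖)

/-- `f : [0, ∞) → ℝ` is smooth and `f(τ) = O(τ)` for small `τ`. -/
structure IsAdmissibleNonlinearity (f : ℝ → ℝ) : Prop where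
  smooth : ContDiffOn ℝ ∞ f (Ici 0)
  small : f =O[𝓝[≥] 0] fun τ => τ

/-- `lam ↦ φ lam`, for `lam` in an open interval `I`, is a differentiable branch of nonlinear ground
states: positive bounded `H¹` solutions of
`-Δ φ + V φ - f(φ²) φ = -lam φ`, depending continuously differentiably on `(lam, x)`,
with `∂φ/∂lam` in `L²`. -/
structure IsGroundStateBranch {d : ℕ} (V : Space d → ℝ) (f : ℝ → ℝ) (I : Set ℝ)
    (φ : ℝ → Space d → ℝ) : Prop where
  isOpen : IsOpen I
  ordConnected : I.OrdConnected
  pos : ∀ lam ∈ I, ∀ x, 0 < φ lam x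
  contDiff : ∀ lam ∈ I, ContDiff ℝ 2 (φ lam)
  equation : ∀ lam ∈ I, ∀ x,
    -(Δ (φ lam)) x + V x * φ lam x - f (φ lam x ^ 2) * φ lam x = -lam * φ lam x
  memLp : ∀ lam ∈ I, MemLp (φ lam) 2 volume
  memLp_fderiv : ∀ lam ∈ I, MemLp (fderiv ℝ (φ lam)) 2 volume
  bounded : ∀ lam ∈ I, ∃ C : ℝ, ∀ x, φ lam x ≤ C
  contDiffOn_param : ContDiffOn ℝ 1 (fun p : ℝ × Space d => φ p.1 p.2) (I ×ˢ univ)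
  memLp_deriv_param : ∀ lam ∈ I, MemLp (fun x => deriv (fun μ => φ μ x) lam) 2 volume

end

end NLS

/-!
The eigenvalue equation `L u = i E u`, written for `u = (ξ, i η)`, is the real system
`L₊ ξ = E η`, `L₋ η = E ξ`. Since its coefficients are real, every complex eigenvector is
`(ξ, i η) + i (ξ', i η')` with two real solutions, so that a real basis of the space of real
solutions (`realModes`) is a complex basis of the eigenspace (`span_complexify_eq`).

On real solutions the pairing `⟨ξ, η'⟩ = E⁻¹ ⟨L₋ η, η'⟩` is symmetric, as `L₋` is, and positive
definite: the positive function `φ` satisfies `L₋ φ = 0`, hence `L₋ ≥ 0` by Picone's inequality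
`|∇u|² - ∇(u² / φ) · ∇φ ≥ 0` (`HasWeakLaplacian.schrodinger_nonneg`), and `⟨L₋ η, η⟩ = 0` forces
`ξ = E⁻¹ L₋ η = 0` and then `η = E⁻¹ L₊ ξ = 0`. An orthonormal basis for this inner product gives
`⟨ξ_n, η_m⟩ = δ`. The remaining relations then hold for all real solutions:

* `2 ⟨f'(φ²) φ² ξ_m, η_n⟩ = ⟨(L₋ - L₊) ξ_m, η_n⟩ = E (⟨ξ_m, ξ_n⟩ - ⟨η_m, η_n⟩)` is symmetric
  (`realModes.inner_coupling`);
* `E ⟨φ, ξ⟩ = ⟨L₋ φ, η⟩ = 0`;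
* `L₊ ∂φ/∂lam = -φ`, so `E ⟨∂φ/∂lam, η⟩ = ⟨L₊ ∂φ/∂lam, ξ⟩ = -⟨φ, ξ⟩ = 0`.

All this takes place in the real Hilbert space `L²(ℝ^d, ℝ)` with the relation `HasWeakLaplacian u g`,
meaning `Δ u = g` as tempered distributions, which describes `H²` exactly
(`exists_laplacianH2_eq_iff_re_im`). Schwartz functions are dense for the graph norm
(`HasWeakLaplacian.exists_schwartz_approx`), which gives the symmetry of the Laplacian and reduces
the positivity of `L₋` to test functions. That `φ` and `∂φ/∂lam` satisfy their equations in this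
sense follows by testing with compactly supported functions
(`hasWeakLaplacian_of_compactSupport`), where the classical equation for `φ` can be integrated by
parts and differentiated in `lam` under the integral.
-/

namespace NLS

open scoped LineDeriv BoundedContinuousFunction

/-! ### Cut-offs of Schwartz functions -/

/-- The dilation `x ↦ (n + 1)⁻¹ x` of `ℝ^d`. -/
noncomputable def dilation (d n : ℕ) : Space d ≃L[ℝ] Space d :=
  ContinuousLinearEquiv.smulLeft (Units.mk0 ((n + 1 : ℝ)⁻¹) (by positivity))

@[simp]
theorem dilation_apply {d : ℕ} (n : ℕ) (x : Space d) : dilation d n x = (n + 1 : ℝ)⁻¹ • x := rfl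

/-- The Schwartz function `x ↦ χ (x / (n + 1)) ψ x`. -/
noncomputable def dilatedMul {d : ℕ} (χ : 𝓢(Space d, ℝ)) (n : ℕ) (ψ : 𝓢(Space d, ℝ)) :
    𝓢(Space d, ℝ) :=
  SchwartzMap.pairing (ContinuousLinearMap.mul ℝ ℝ)
    (SchwartzMap.compCLMOfContinuousLinearEquiv ℝ (dilation d n) χ) ψ

theorem dilatedMul_apply {d : ℕ} (χ : 𝓢(Space d, ℝ)) (n : ℕ) (ψ : 𝓢(Space d, ℝ)) (x : Space d) :
    dilatedMul χ n ψ x = χ ((n + 1 : ℝ)⁻¹ • x) * ψ x := by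
  simp [dilatedMul, SchwartzMap.pairing_apply_apply]

theorem lineDeriv_dilatedMul {d : ℕ} (χ : 𝓢(Space d, ℝ)) (n : ℕ) (ψ : 𝓢(Space d, ℝ))
    (m : Space d) :
    ∂_{m} (dilatedMul χ n ψ) =
      dilatedMul χ n (∂_{m} ψ) + (n + 1 : ℝ)⁻¹ • dilatedMul (∂_{m} χ) n ψ := by
  ext x
  have h1 : HasFDerivAt (fun x : Space d => χ ((n + 1 : ℝ)⁻¹ • x))
      ((fderiv ℝ χ ((n + 1 : ℝ)⁻¹ • x)).comp (dilation d n : Space d →L[ℝ] Space d)) x :=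
    (χ.hasFDerivAt (dilation d n x)).comp x (dilation d n).hasFDerivAt
  have h2 := h1.mul (ψ.hasFDerivAt x)
  have h3 : (dilatedMul χ n ψ : Space d → ℝ) =
      (fun x : Space d => χ ((n + 1 : ℝ)⁻¹ • x)) * ψ := by
    ext y
    exact dilatedMul_apply χ n ψ y
  rw [SchwartzMap.lineDerivOp_apply_eq_fderiv, h3, h2.fderiv]
  simp [dilatedMul_apply, SchwartzMap.lineDerivOp_apply_eq_fderiv]
  ring

theorem laplacian_dilatedMul {d : ℕ} (e : OrthonormalBasis (Fin d) ℝ (Space d))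
    (χ : 𝓢(Space d, ℝ)) (n : ℕ) (ψ : 𝓢(Space d, ℝ)) :
    Δ (dilatedMul χ n ψ) = dilatedMul χ n (Δ ψ) + (n + 1 : ℝ)⁻¹ •
      (∑ i, (2 : ℝ) • dilatedMul (∂_{e i} χ) n (∂_{e i} ψ) +
        (n + 1 : ℝ)⁻¹ • dilatedMul (Δ χ) n ψ) := by
  simp_rw [SchwartzMap.laplacian_eq_sum e, lineDeriv_dilatedMul, LineDeriv.lineDerivOp_add,
    LineDeriv.lineDerivOp_smul,
    lineDeriv_dilatedMul]
  ext x
  simp only [dilatedMul_apply, sum_apply, add_apply, smul_apply,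
    smul_eq_mul, Finset.mul_sum, Finset.sum_mul, ← Finset.sum_add_distrib]
  exact Finset.sum_congr rfl fun i _ => by ring

theorem abs_dilatedMul_le {d : ℕ} (χ : 𝓢(Space d, ℝ)) :
    ∃ C, 0 ≤ C ∧ ∀ (n : ℕ) (ψ : 𝓢(Space d, ℝ)) x, |dilatedMul χ n ψ x| ≤ C * |ψ x| := by
  refine ⟨SchwartzMap.seminorm ℝ 0 0 χ, apply_nonneg _ _, fun n ψ x => ?_⟩
  rw [dilatedMul_apply, abs_mul]
  gcongr
  exact χ.norm_le_seminorm ℝ _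

theorem tendsto_inv_natCast_succ : Tendsto (fun n : ℕ => (n + 1 : ℝ)⁻¹) atTop (𝓝 0) := by
  simpa using tendsto_one_div_add_atTop_nhds_zero_nat (𝕜 := ℝ)

theorem tendsto_dilatedMul {d : ℕ} (χ ψ : 𝓢(Space d, ℝ)) (x : Space d) :
    Tendsto (fun n => dilatedMul χ n ψ x) atTop (𝓝 (χ 0 * ψ x)) := by
  simp_rw [dilatedMul_apply]
  have h : Tendsto (fun n : ℕ => (n + 1 : ℝ)⁻¹ • x) atTop (𝓝 0) := by
    simpa using tendsto_inv_natCast_succ.smul_const x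
  exact ((χ.continuous.tendsto 0).comp h).mul_const _

/-- A smooth cut-off function: compactly supported and equal to one at the origin. -/
theorem exists_cutoff (d : ℕ) : ∃ χ : 𝓢(Space d, ℝ), HasCompactSupport χ ∧ χ 0 = 1 := by
  let b : ContDiffBump (0 : Space d) := ⟨1, 2, by norm_num, by norm_num⟩
  refine ⟨b.hasCompactSupport.toSchwartzMap b.contDiff, b.hasCompactSupport, ?_⟩
  exact b.one_of_mem_closedBall (by simp [b])

/-- Every Schwartz function is a limit of compactly supported ones: the functions, their gradients
and their Laplacians converge pointwise, with a common square-integrable bound. -/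
theorem exists_compactSupport_approx {d : ℕ} (e : OrthonormalBasis (Fin d) ℝ (Space d))
    (ψ : 𝓢(Space d, ℝ)) :
    ∃ (θ : ℕ → 𝓢(Space d, ℝ)) (G : Space d → ℝ), (∀ n, HasCompactSupport (θ n)) ∧
      MemLp G 2 volume ∧
      (∀ n x, |θ n x| ≤ G x) ∧ (∀ x, Tendsto (fun n => θ n x) atTop (𝓝 (ψ x))) ∧
      (∀ n x, |(Δ (θ n)) x| ≤ G x) ∧
      (∀ x, Tendsto (fun n => (Δ (θ n)) x) atTop (𝓝 ((Δ ψ) x))) ∧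
      (∀ i n x, |(∂_{e i} (θ n)) x| ≤ G x) ∧
      (∀ i x, Tendsto (fun n => (∂_{e i} (θ n)) x) atTop
        (𝓝 ((∂_{e i} ψ) x))) := by
  obtain ⟨χ, hχ, hχ0⟩ := exists_cutoff d
  obtain ⟨C, hC0, hC⟩ := abs_dilatedMul_le χ
  choose D hD0 hD using fun i => abs_dilatedMul_le (∂_{e i} χ)
  obtain ⟨K, hK0, hK⟩ := abs_dilatedMul_le (Δ χ)
  have hle : ∀ n : ℕ, |(n + 1 : ℝ)⁻¹| ≤ 1 := fun n => by
    rw [abs_of_nonneg (by positivity)]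
    exact inv_le_one_of_one_le₀ (by linarith [Nat.cast_nonneg (α := ℝ) n])
  have hlim0 := tendsto_inv_natCast_succ
  set G : Space d → ℝ := fun x => C * |ψ x| + (C * |(Δ ψ) x| +
    (∑ i, 2 * (D i * |(∂_{e i} ψ) x|) + K * |ψ x|)) + ∑ i, (C * |(∂_{e i} ψ) x| + D i * |ψ x|)
    with hG
  have e1 : ∀ x, 0 ≤ C * |ψ x| := fun x => by positivity
  have e2 : ∀ x, 0 ≤ C * |(Δ ψ) x| + (∑ i, 2 * (D i * |(∂_{e i} ψ) x|) + K * |ψ x|) := fun x => by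
    have := Finset.sum_nonneg fun i (_ : i ∈ Finset.univ) =>
      mul_nonneg zero_le_two (mul_nonneg (hD0 i) (abs_nonneg ((∂_{e i} ψ) x)))
    positivity
  have e3 : ∀ x i, 0 ≤ C * |(∂_{e i} ψ) x| + D i * |ψ x| := fun x i => by
    have := hD0 i
    positivity
  have e3' : ∀ x, 0 ≤ ∑ i, (C * |(∂_{e i} ψ) x| + D i * |ψ x|) :=
    fun x => Finset.sum_nonneg fun i _ => e3 x i
  refine ⟨fun n => dilatedMul χ n ψ, G, fun n => ?_, ?_, fun n x => ?_, fun x => ?_, fun n x => ?_,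
    fun x => ?_, fun i n x => ?_, fun i x => ?_⟩
  · have h : (dilatedMul χ n ψ : Space d → ℝ) = (χ ∘ dilation d n) * ψ := by
      ext y
      exact dilatedMul_apply χ n ψ y
    rw [h]
    exact (hχ.comp_homeomorph (dilation d n).toHomeomorph).mul_right
  · have hs : ∀ θ : 𝓢(Space d, ℝ), ∀ c : ℝ, MemLp (fun x => c * |θ x|) 2 volume :=
      fun θ c => MemLp.const_mul (f := fun x => |θ x|) (θ.memLp 2).abs c
    refine ((hs _ _).add ((hs _ _).add ((memLp_finsetSum _ fun i _ => ?_).add (hs _ _)))).add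
      (memLp_finsetSum _ fun i _ => (hs _ _).add (hs _ _))
    exact (hs _ _).const_mul 2
  · linarith [hC n ψ x, e1 x, e2 x, e3' x]
  · simpa [hχ0] using tendsto_dilatedMul χ ψ x
  · have h : |(Δ (dilatedMul χ n ψ)) x| ≤
        C * |(Δ ψ) x| + (∑ i, 2 * (D i * |(∂_{e i} ψ) x|) + K * |ψ x|) := by
      rw [laplacian_dilatedMul e, add_apply, smul_apply,
        add_apply, smul_apply, sum_apply]
      refine (abs_add_le _ _).trans (add_le_add (hC _ _ _) ?_)
      rw [smul_eq_mul, abs_mul]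
      refine (mul_le_of_le_one_left (abs_nonneg _) (hle n)).trans ?_
      refine (abs_add_le _ _).trans (add_le_add ?_ ?_)
      · refine (Finset.abs_sum_le_sum_abs _ _).trans (Finset.sum_le_sum fun i _ => ?_)
        rw [smul_apply, smul_eq_mul, abs_mul, abs_two]
        exact mul_le_mul_of_nonneg_left (hD i _ _ _) zero_le_two
      · rw [smul_eq_mul, abs_mul]
        exact (mul_le_of_le_one_left (abs_nonneg _) (hle n)).trans (hK _ _ _)
    linarith [e1 x, e3' x]
  · simp_rw [laplacian_dilatedMul e, add_apply, smul_apply,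
        add_apply, smul_apply, sum_apply,
        smul_apply]
    have h1 := tendsto_dilatedMul χ (Δ ψ) x
    have h2 : Tendsto (fun n => ∑ i, (2 : ℝ) • dilatedMul (∂_{e i} χ) n (∂_{e i} ψ) x) atTop
        (𝓝 (∑ i, (2 : ℝ) • ((∂_{e i} χ) 0 * (∂_{e i} ψ) x))) :=
      tendsto_finsetSum _ fun i _ => (tendsto_dilatedMul _ _ x).const_smul 2
    simpa [hχ0] using h1.add (hlim0.smul (h2.add (hlim0.smul (tendsto_dilatedMul (Δ χ) ψ x))))
  · have h : |(∂_{e i} (dilatedMul χ n ψ)) x| ≤ C * |(∂_{e i} ψ) x| + D i * |ψ x| := by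
      rw [lineDeriv_dilatedMul, add_apply, smul_apply]
      refine (abs_add_le _ _).trans (add_le_add (hC _ _ _) ?_)
      rw [smul_eq_mul, abs_mul]
      exact (mul_le_of_le_one_left (abs_nonneg _) (hle n)).trans (hD _ _ _ _)
    have := Finset.single_le_sum (fun i _ => e3 x i) (Finset.mem_univ i)
    linarith [e1 x, e2 x]
  · simp_rw [lineDeriv_dilatedMul, add_apply, smul_apply]
    simpa [hχ0] using (tendsto_dilatedMul χ (∂_{e i} ψ) x).add
      (hlim0.smul (tendsto_dilatedMul (∂_{e i} χ) ψ x))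

/-! ### The weak Laplacian on `L²` -/

/-- The real Hilbert space `L²(ℝ^d, ℝ)`. -/
noncomputable abbrev RealL2 (d : ℕ) := Lp ℝ 2 (volume : Measure (Space d))

theorem inner_eq_integral {d : ℕ} {u v : RealL2 d} {a b : Space d → ℝ}
    (ha : u =ᵐ[volume] a) (hb : v =ᵐ[volume] b) : inner ℝ u v = ∫ x, a x * b x := by
  rw [L2.inner_def]
  refine integral_congr_ae ?_
  filter_upwards [ha, hb] with x h1 h2
  rw [h1, h2, real_inner_comm]
  rfl

/-- Schwartz functions as elements of `L²`. -/
noncomputable def toL2 {d : ℕ} : 𝓢(Space d, ℝ) →L[ℝ] RealL2 d := SchwartzMap.toLpCLM ℝ ℝ 2 volume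

theorem coeFn_toL2 {d : ℕ} (ψ : 𝓢(Space d, ℝ)) : toL2 ψ =ᵐ[volume] ψ :=
  ψ.coeFn_toLp 2

/-- `g` is the Laplacian of `u` in the sense of real tempered distributions. -/
def HasWeakLaplacian {d : ℕ} (u g : RealL2 d) : Prop :=
  ∀ ψ : 𝓢(Space d, ℝ), inner ℝ u (toL2 (Δ ψ)) = inner ℝ g (toL2 ψ)

theorem hasWeakLaplacian_iff {d : ℕ} {u g : RealL2 d} : HasWeakLaplacian u g ↔
    ∀ ψ : 𝓢(Space d, ℝ), ∫ x, u x * (Δ ψ) x = ∫ x, g x * ψ x := by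
  refine forall_congr' fun ψ => ?_
  rw [inner_eq_integral EventuallyEq.rfl (coeFn_toL2 (Δ ψ)),
    inner_eq_integral EventuallyEq.rfl (coeFn_toL2 ψ)]

theorem integrable_mul_schwartz {d : ℕ} (u : RealL2 d) (ψ : 𝓢(Space d, ℝ)) :
    Integrable (fun x => u x * ψ x) :=
  (Lp.memLp u).integrable_mul (ψ.memLp 2)

/-- It suffices to test a weak Laplacian against compactly supported functions. -/
theorem hasWeakLaplacian_of_compactSupport {d : ℕ} {u g : RealL2 d}
    (h : ∀ ψ : 𝓢(Space d, ℝ), HasCompactSupport ψ →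
      ∫ x, u x * (Δ ψ) x = ∫ x, g x * ψ x) : HasWeakLaplacian u g := by
  rw [hasWeakLaplacian_iff]
  intro ψ
  obtain ⟨θ, G, hc, hG, h0, l0, h2, l2, -⟩ :=
    exists_compactSupport_approx (EuclideanSpace.basisFun (Fin d) ℝ) ψ
  have key : ∀ (w : RealL2 d) (a : ℕ → 𝓢(Space d, ℝ)) (b : 𝓢(Space d, ℝ)),
      (∀ n x, |a n x| ≤ G x) → (∀ x, Tendsto (fun n => a n x) atTop (𝓝 (b x))) →
      Tendsto (fun n => ∫ x, w x * a n x) atTop (𝓝 (∫ x, w x * b x)) := by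
    intro w a b hb hl
    refine tendsto_integral_of_dominated_convergence (fun x => |w x| * G x)
      (fun n => (integrable_mul_schwartz w (a n)).aestronglyMeasurable)
      ((Lp.memLp w).abs.integrable_mul hG) (fun n => .of_forall fun x => ?_)
      (.of_forall fun x => (hl x).const_mul _)
    rw [Real.norm_eq_abs, abs_mul]
    exact mul_le_mul_of_nonneg_left (hb n x) (abs_nonneg _)
  refine tendsto_nhds_unique (key u (fun n => Δ (θ n)) (Δ ψ) h2 l2) ?_
  simp_rw [fun n => h (θ n) (hc n)]
  exact key g θ ψ h0 l0

theorem inner_toL2_toL2 {d : ℕ} (a b : 𝓢(Space d, ℝ)) :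
    inner ℝ (toL2 a) (toL2 b) = ∫ x, a x * b x :=
  inner_eq_integral (coeFn_toL2 a) (coeFn_toL2 b)

theorem hasWeakLaplacian_toL2 {d : ℕ} (a : 𝓢(Space d, ℝ)) :
    HasWeakLaplacian (toL2 a) (toL2 (Δ a)) := fun ψ => by
  rw [inner_toL2_toL2, inner_toL2_toL2]
  exact SchwartzMap.integral_mul_laplacian_right_eq_left a ψ

/-- The Dirichlet integral of a Schwartz function. -/
theorem inner_laplacian_self {d : ℕ} (e : OrthonormalBasis (Fin d) ℝ (Space d))
    (a : 𝓢(Space d, ℝ)) :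
    inner ℝ (toL2 a) (toL2 (Δ a)) = -∑ i, ∫ x, (∂_{e i} a) x ^ 2 := by
  rw [inner_toL2_toL2, SchwartzMap.laplacian_eq_sum e]
  simp_rw [sum_apply, Finset.mul_sum]
  rw [integral_finsetSum]
  · simp [SchwartzMap.integral_mul_lineDerivOp_right_eq_neg_left, pow_two]
  · exact fun i _ => (a.memLp 2).integrable_mul ((∂_{e i} (∂_{e i} a)).memLp 2)

theorem inner_laplacian_self_nonpos {d : ℕ} (a : 𝓢(Space d, ℝ)) :
    inner ℝ (toL2 a) (toL2 (Δ a)) ≤ 0 := by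
  rw [inner_laplacian_self (EuclideanSpace.basisFun (Fin d) ℝ)]
  exact neg_nonpos.mpr (Finset.sum_nonneg fun i _ => integral_nonneg fun x => sq_nonneg _)

/-! ### Density of Schwartz functions in the graph norm -/

/-- The constant for which `1 - resolventScale • Δ` is the Fourier multiplier `1 + ‖x‖²`. -/
noncomputable def resolventScale : ℝ := ((2 * Real.pi) ^ 2)⁻¹

theorem resolventScale_pos : 0 < resolventScale := by
  unfold resolventScale
  positivity

/-- Division of the Fourier transform by `1 + ‖x‖²` inverts `1 - resolventScale • Δ`. -/
theorem exists_complex_resolvent {d : ℕ} (h : 𝓢(Space d, ℂ)) :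
    ∃ a : 𝓢(Space d, ℂ), a - resolventScale • Δ a = h := by
  have hg : (fun x : Space d => (1 + ‖x‖ ^ 2) ^ (-1 : ℝ)).HasTemperateGrowth := by fun_prop
  have hq : (fun x : Space d => ‖x‖ ^ 2).HasTemperateGrowth := by fun_prop
  refine ⟨SchwartzMap.fourierMultiplierCLM ℂ (fun x => (1 + ‖x‖ ^ 2) ^ (-1 : ℝ)) h, ?_⟩
  rw [SchwartzMap.laplacian_eq_fourierMultiplierCLM, smul_smul]
  have hs : resolventScale * -(2 * Real.pi) ^ 2 = -1 := by
    unfold resolventScale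
    field_simp
  rw [hs]
  have : (fun x : Space d => ‖x‖ ^ 2) = (‖·‖ ^ 2) := rfl
  rw [← this, SchwartzMap.fourierMultiplierCLM_fourierMultiplierCLM_apply hq hg, neg_one_smul,
    sub_neg_eq_add, SchwartzMap.fourierMultiplierCLM_apply, SchwartzMap.fourierMultiplierCLM_apply,
    ← FourierTransform.fourierInv_add]
  have hsum : SchwartzMap.smulLeftCLM ℂ (fun x : Space d => (1 + ‖x‖ ^ 2) ^ (-1 : ℝ))
        (FourierTransform.fourier h) +
      SchwartzMap.smulLeftCLM ℂ ((fun x : Space d => ‖x‖ ^ 2) *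
        fun x => (1 + ‖x‖ ^ 2) ^ (-1 : ℝ)) (FourierTransform.fourier h) =
      FourierTransform.fourier h := by
    ext x
    rw [add_apply, SchwartzMap.smulLeftCLM_apply_apply hg,
      SchwartzMap.smulLeftCLM_apply_apply (hq.mul hg), ← add_smul, Pi.mul_apply]
    have : (1 + ‖x‖ ^ 2) ≠ 0 := by positivity
    rw [Real.rpow_neg_one, ← one_add_mul, mul_inv_cancel₀ this, one_smul]
  rw [hsum, FourierTransform.fourierInv_fourier_eq]

/-- The Laplacian commutes with linear maps on values, such as real and imaginary parts. -/
theorem laplacian_postcomp {d : ℕ} {F G : Type*} [NormedAddCommGroup F] [NormedSpace ℝ F]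
    [NormedAddCommGroup G] [NormedSpace ℝ G] (l : F →L[ℝ] G) (a : 𝓢(Space d, F)) :
    Δ (SchwartzMap.postcompCLM l a) = SchwartzMap.postcompCLM l (Δ a) := by
  ext x
  rw [SchwartzMap.laplacian_apply, SchwartzMap.postcompCLM_apply, SchwartzMap.laplacian_apply]
  exact (a.contDiffAt 2).laplacian_CLM_comp_left

/-- The resolvent of the Laplacian preserves real Schwartz functions. -/
theorem exists_resolvent {d : ℕ} (h : 𝓢(Space d, ℝ)) :
    ∃ a : 𝓢(Space d, ℝ), a - resolventScale • Δ a = h := by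
  obtain ⟨a, ha⟩ := exists_complex_resolvent (SchwartzMap.postcompCLM Complex.ofRealCLM h)
  refine ⟨SchwartzMap.postcompCLM Complex.reCLM a, ?_⟩
  have h1 : (SchwartzMap.postcompCLM Complex.reCLM (SchwartzMap.postcompCLM Complex.ofRealCLM h)) =
      h := by
    ext x
    simp
  rw [laplacian_postcomp, ← map_smul, ← map_sub, ha, h1]

theorem norm_le_norm_sub_laplacian {d : ℕ} (a : 𝓢(Space d, ℝ)) :
    ‖toL2 a‖ ≤ ‖toL2 (a - resolventScale • Δ a)‖ := by
  refine le_of_sq_le_sq ?_ (norm_nonneg _)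
  rw [map_sub, map_smul, @norm_sub_sq_real, inner_smul_right]
  nlinarith [inner_laplacian_self_nonpos a, resolventScale_pos,
    mul_nonneg resolventScale_pos.le (neg_nonneg.mpr (inner_laplacian_self_nonpos a)),
    sq_nonneg ‖resolventScale • toL2 (Δ a)‖]

theorem denseRange_toL2 (d : ℕ) : DenseRange fun ψ : 𝓢(Space d, ℝ) => toL2 ψ :=
  SchwartzMap.denseRange_toLpCLM (p := 2) (by simp)

/-- The resolvent `(1 - resolventScale • Δ)⁻¹` is a contraction of `L²`; the estimate is proved by
duality against Schwartz functions. -/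
theorem HasWeakLaplacian.norm_le {d : ℕ} {u g : RealL2 d} (h : HasWeakLaplacian u g) :
    ‖u‖ ≤ ‖u - resolventScale • g‖ := by
  have key : ∀ v : RealL2 d, inner ℝ u v ≤ ‖u - resolventScale • g‖ * ‖v‖ := by
    intro v
    refine (denseRange_toL2 d).induction_on
      (p := fun v => inner ℝ u v ≤ ‖u - resolventScale • g‖ * ‖v‖) v ?_ ?_
    · exact isClosed_le (by fun_prop) (by fun_prop)
    · intro ψ
      obtain ⟨a, rfl⟩ := exists_resolvent ψ
      have h1 : inner ℝ u (toL2 (a - resolventScale • Δ a)) =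
          inner ℝ (u - resolventScale • g) (toL2 a) := by
        rw [map_sub, map_smul, inner_sub_right, inner_sub_left, inner_smul_right, h a,
          real_inner_smul_left]
      rw [h1]
      exact (real_inner_le_norm _ _).trans
        (mul_le_mul_of_nonneg_left (norm_le_norm_sub_laplacian a) (norm_nonneg _))
  have := key u
  rw [real_inner_self_eq_norm_sq] at this
  by_contra! hlt
  nlinarith [norm_nonneg (u - resolventScale • g)]

theorem HasWeakLaplacian.sub {d : ℕ} {u g w k : RealL2 d} (h : HasWeakLaplacian u g)
    (h' : HasWeakLaplacian w k) : HasWeakLaplacian (u - w) (g - k) := fun ψ => by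
  rw [inner_sub_left, inner_sub_left, h ψ, h' ψ]

theorem HasWeakLaplacian.add {d : ℕ} {u g w k : RealL2 d} (h : HasWeakLaplacian u g)
    (h' : HasWeakLaplacian w k) : HasWeakLaplacian (u + w) (g + k) := fun ψ => by
  rw [inner_add_left, inner_add_left, h ψ, h' ψ]

theorem HasWeakLaplacian.smul {d : ℕ} {u g : RealL2 d} (c : ℝ) (h : HasWeakLaplacian u g) :
    HasWeakLaplacian (c • u) (c • g) := fun ψ => by
  rw [real_inner_smul_left, real_inner_smul_left, h ψ]

/-- Schwartz functions are dense in the domain of the Laplacian for the graph norm. -/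
theorem HasWeakLaplacian.exists_schwartz_approx {d : ℕ} {u g : RealL2 d}
    (h : HasWeakLaplacian u g) : ∃ a : ℕ → 𝓢(Space d, ℝ),
      Tendsto (fun n => toL2 (a n)) atTop (𝓝 u) ∧
      Tendsto (fun n => toL2 (Δ (a n))) atTop (𝓝 g) := by
  obtain ⟨s, hs⟩ : ∃ s : ℕ → 𝓢(Space d, ℝ),
      Tendsto (fun n => toL2 (s n)) atTop (𝓝 (u - resolventScale • g)) := by
    obtain ⟨t, ht, hlim⟩ := mem_closure_iff_seq_limit.mp (denseRange_toL2 d (u - resolventScale • g))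
    choose s hs using ht
    exact ⟨s, by simpa [hs] using hlim⟩
  -- Apply the resolvent to approximations of `u - resolventScale • g`; it is a contraction.
  choose a ha using fun n => exists_resolvent (s n)
  have hw : ∀ n, HasWeakLaplacian (toL2 (a n) - u) (toL2 (Δ (a n)) - g) :=
    fun n => (hasWeakLaplacian_toL2 (a n)).sub h
  have hdiff : ∀ n, (toL2 (a n) - u) - resolventScale • (toL2 (Δ (a n)) - g) =
      toL2 (s n) - (u - resolventScale • g) := fun n => by
    rw [← ha n, map_sub, map_smul, smul_sub]
    abel
  have h1 : Tendsto (fun n => toL2 (a n)) atTop (𝓝 u) := by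
    rw [tendsto_iff_norm_sub_tendsto_zero] at hs ⊢
    exact squeeze_zero (fun _ => norm_nonneg _) (fun n => hdiff n ▸ (hw n).norm_le) hs
  refine ⟨a, h1, ?_⟩
  have h2 := (h1.sub hs).const_smul resolventScale⁻¹
  have h3 : resolventScale⁻¹ • (u - (u - resolventScale • g)) = g := by
    rw [sub_sub_cancel, smul_smul, inv_mul_cancel₀ resolventScale_pos.ne', one_smul]
  rw [h3] at h2
  refine h2.congr fun n => ?_
  rw [← ha n, map_sub, map_smul, sub_sub_cancel, smul_smul,
    inv_mul_cancel₀ resolventScale_pos.ne', one_smul]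

/-- The Laplacian is symmetric on its maximal domain. -/
theorem HasWeakLaplacian.symm {d : ℕ} {u g w k : RealL2 d} (h : HasWeakLaplacian u g)
    (h' : HasWeakLaplacian w k) : inner ℝ g w = inner ℝ u k := by
  obtain ⟨a, h1, h2⟩ := h'.exists_schwartz_approx
  refine tendsto_nhds_unique (tendsto_const_nhds.inner h1) ?_
  simp_rw [← h (a _)]
  exact tendsto_const_nhds.inner h2

/-! ### Integration by parts for classical derivatives -/

theorem integral_mul_fderiv_of_compactSupport {d : ℕ} {f g : Space d → ℝ} (hf : ContDiff ℝ 1 f)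
    (hg : ContDiff ℝ 1 g) (hc : HasCompactSupport g) (v : Space d) :
    ∫ x, f x * fderiv ℝ g x v = -∫ x, fderiv ℝ f x v * g x := by
  have hf' : Continuous fun x => fderiv ℝ f x v := by fun_prop (disch := norm_num)
  have hg' : Continuous fun x => fderiv ℝ g x v := by fun_prop (disch := norm_num)
  have hc' : HasCompactSupport fun x => fderiv ℝ g x v := hc.fderiv_apply ℝ v
  refine integral_mul_fderiv_eq_neg_fderiv_mul_of_integrable ?_ ?_ ?_
    (fun x _ => (hf.differentiable (by norm_num)).differentiableAt)
    (fun x _ => (hg.differentiable (by norm_num)).differentiableAt)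
  · exact (hf'.mul hg.continuous).integrable_of_hasCompactSupport hc.mul_left
  · exact (hf.continuous.mul hg').integrable_of_hasCompactSupport hc'.mul_left
  · exact (hf.continuous.mul hg.continuous).integrable_of_hasCompactSupport hc.mul_left

theorem contDiff_fderiv_apply {d : ℕ} {φ : Space d → ℝ} (hφ : ContDiff ℝ 2 φ) (v : Space d) :
    ContDiff ℝ 1 fun x => fderiv ℝ φ x v :=
  (hφ.fderiv_right (m := 1) (by norm_num)).clm_apply contDiff_const

theorem laplacian_eq_sum_fderiv {d : ℕ} (e : OrthonormalBasis (Fin d) ℝ (Space d))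
    {φ : Space d → ℝ} (hφ : ContDiff ℝ 2 φ) (x : Space d) :
    (Δ φ) x = ∑ i, fderiv ℝ (fun y => fderiv ℝ φ y (e i)) x (e i) := by
  rw [InnerProductSpace.laplacian_eq_iteratedFDeriv_orthonormalBasis φ e]
  refine Finset.sum_congr rfl fun i _ => ?_
  have h : DifferentiableAt ℝ (fderiv ℝ φ) x :=
    ((hφ.fderiv_right (m := 1) (by norm_num)).differentiable (by norm_num)).differentiableAt
  rw [iteratedFDeriv_two_apply, fderiv_clm_apply h (differentiableAt_const _)]
  simp

/-- Green's first identity. -/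
theorem integral_mul_laplacian_eq_neg {d : ℕ} (e : OrthonormalBasis (Fin d) ℝ (Space d))
    {φ θ : Space d → ℝ} (hφ : ContDiff ℝ 2 φ) (hθ : ContDiff ℝ 1 θ) (hc : HasCompactSupport θ) :
    ∫ x, θ x * (Δ φ) x = -∑ i, ∫ x, fderiv ℝ θ x (e i) * fderiv ℝ φ x (e i) := by
  simp_rw [laplacian_eq_sum_fderiv e hφ, Finset.mul_sum]
  rw [integral_finsetSum, ← Finset.sum_neg_distrib]
  · refine Finset.sum_congr rfl fun i _ => ?_
    have := integral_mul_fderiv_of_compactSupport (contDiff_fderiv_apply hφ (e i)) hθ hc (e i)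
    simp_rw [mul_comm (fderiv ℝ θ _ _), this, neg_neg, mul_comm (θ _)]
  · intro i _
    have h1 : Continuous fun x => fderiv ℝ (fun y => fderiv ℝ φ y (e i)) x (e i) :=
      ((contDiff_fderiv_apply hφ (e i)).continuous_fderiv (by norm_num)).clm_apply
        continuous_const
    exact (hθ.continuous.mul h1).integrable_of_hasCompactSupport hc.mul_right

/-- Green's second identity. -/
theorem integral_mul_laplacian_comm {d : ℕ} {φ : Space d → ℝ} (hφ : ContDiff ℝ 2 φ)
    (ψ : 𝓢(Space d, ℝ)) (hc : HasCompactSupport ψ) :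
    ∫ x, φ x * (Δ ψ) x = ∫ x, (Δ φ) x * ψ x := by
  let e := EuclideanSpace.basisFun (Fin d) ℝ
  simp_rw [mul_comm ((Δ φ) _)]
  rw [integral_mul_laplacian_eq_neg e hφ (ψ.smooth 1) hc]
  simp_rw [SchwartzMap.laplacian_eq_sum e, sum_apply, Finset.mul_sum]
  have hi : ∀ i, HasCompactSupport (∂_{e i} ψ : 𝓢(Space d, ℝ)) :=
    fun i => hc.fderiv_apply ℝ (e i)
  rw [integral_finsetSum, ← Finset.sum_neg_distrib]
  · refine Finset.sum_congr rfl fun i _ => ?_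
    have := integral_mul_fderiv_of_compactSupport (hφ.of_le (by norm_num)) ((∂_{e i} ψ).smooth 1)
      (hi i) (e i)
    simp_rw [SchwartzMap.lineDerivOp_apply_eq_fderiv (e i) (∂_{e i} ψ), this,
      SchwartzMap.lineDerivOp_apply_eq_fderiv, mul_comm]
  · intro i _
    exact (hφ.continuous.mul (∂_{e i} (∂_{e i} ψ)).continuous).integrable_of_hasCompactSupport
      (HasCompactSupport.mul_left ((hi i).fderiv_apply ℝ (e i)))

/-! ### Positivity of Schrödinger operators with a positive solution -/

/-- Picone's inequality, integrated: a Schrödinger operator `-Δ + W` that annihilates a positive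
function `φ` has a nonnegative quadratic form on compactly supported functions, because
`|∇u|² - ∇(u² / φ) · ∇φ = |∇u - u ∇φ / φ|²`. -/
theorem dirichlet_form_nonneg_of_compactSupport {d : ℕ}
    (e : OrthonormalBasis (Fin d) ℝ (Space d)) {φ W : Space d → ℝ} (hφ : ContDiff ℝ 2 φ)
    (hpos : ∀ x, 0 < φ x) (hW : ∀ x, (Δ φ) x = W x * φ x) (u : 𝓢(Space d, ℝ))
    (hc : HasCompactSupport u) :
    0 ≤ (∑ i, ∫ x, (∂_{e i} u) x ^ 2) + ∫ x, W x * u x ^ 2 := by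
  have hu : ContDiff ℝ 1 u := u.smooth 1
  have hφ1 : ContDiff ℝ 1 φ := hφ.of_le (by norm_num)
  set w : Space d → ℝ := fun x => u x ^ 2 / φ x with hw
  have hw1 : ContDiff ℝ 1 w := (hu.pow 2).div hφ1 fun x => (hpos x).ne'
  have hwc : HasCompactSupport w := by
    refine hc.mono fun x hx => ?_
    contrapose! hx
    simp_all [w]
  have hpot : ∫ x, W x * u x ^ 2 = ∫ x, w x * (Δ φ) x := by
    refine integral_congr_ae (.of_forall fun x => ?_)
    have := (hpos x).ne'
    simp only [hw, hW]
    field_simp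
  rw [hpot, integral_mul_laplacian_eq_neg e hφ hw1 hwc, ← sub_eq_add_neg, ← Finset.sum_sub_distrib]
  refine Finset.sum_nonneg fun i _ => ?_
  have hwi : Continuous fun x => fderiv ℝ w x (e i) :=
    (hw1.continuous_fderiv (by norm_num)).clm_apply continuous_const
  have hφi : Continuous fun x => fderiv ℝ φ x (e i) :=
    (hφ1.continuous_fderiv (by norm_num)).clm_apply continuous_const
  rw [← integral_sub]
  · refine integral_nonneg fun x => ?_
    have hp := (hpos x).ne'
    have h1 : HasFDerivAt (fun x => u x ^ 2) ((2 * u x) • fderiv ℝ u x) x := by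
      simpa using (u.hasFDerivAt x).pow 2
    have h2 : HasFDerivAt (fun x => (φ x)⁻¹) (-(φ x ^ 2)⁻¹ • fderiv ℝ φ x) x := by
      have := (hφ1.differentiable (by norm_num) x).hasFDerivAt
      exact (hasDerivAt_inv hp).comp_hasFDerivAt x this
    have h3 : fderiv ℝ w x (e i) = u x ^ 2 * (-(φ x ^ 2)⁻¹ * fderiv ℝ φ x (e i)) +
        (φ x)⁻¹ * (2 * u x * fderiv ℝ u x (e i)) := by
      have h4 := h1.mul h2
      have h5 : w = (fun x => u x ^ 2) * fun x => (φ x)⁻¹ := by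
        ext y
        simp [hw, div_eq_mul_inv]
      rw [h5, h4.fderiv]
      simp
    have h6 : (∂_{e i} u) x ^ 2 - fderiv ℝ w x (e i) * fderiv ℝ φ x (e i) =
        (fderiv ℝ u x (e i) - u x / φ x * fderiv ℝ φ x (e i)) ^ 2 := by
      rw [h3, SchwartzMap.lineDerivOp_apply_eq_fderiv]
      field_simp
      ring
    simp only [Pi.zero_apply, h6]
    positivity
  · exact ((∂_{e i} u).memLp 2).integrable_sq
  · exact (hwi.mul hφi).integrable_of_hasCompactSupport
      (HasCompactSupport.mul_right (hwc.fderiv_apply ℝ (e i)))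

/-! ### Multiplication by bounded functions -/

theorem memLp_mul {d : ℕ} (W : Space d →ᵇ ℝ) (u : RealL2 d) :
    MemLp (fun x => W x * u x) 2 volume :=
  (Lp.memLp u).mul W.memLp_top

/-- Multiplication by a bounded continuous function on `L²`. -/
noncomputable def mulL2 {d : ℕ} (W : Space d →ᵇ ℝ) : RealL2 d →L[ℝ] RealL2 d :=
  LinearMap.mkContinuous
    { toFun := fun u => (memLp_mul W u).toLp
      map_add' := fun u w => by
        ext1
        refine (MemLp.coeFn_toLp _).trans ?_
        filter_upwards [Lp.coeFn_add u w, Lp.coeFn_add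
          ((memLp_mul W u).toLp)
          ((memLp_mul W w).toLp),
          MemLp.coeFn_toLp (memLp_mul W u),
          MemLp.coeFn_toLp (memLp_mul W w)]
          with x h1 h2 h3 h4
        rw [h2, Pi.add_apply, h3, h4]
        simp only [h1, Pi.add_apply, mul_add]
      map_smul' := fun c u => by
        ext1
        refine (MemLp.coeFn_toLp _).trans ?_
        filter_upwards [Lp.coeFn_smul c u, Lp.coeFn_smul c
          ((memLp_mul W u).toLp),
          MemLp.coeFn_toLp (memLp_mul W u)]
          with x h1 h2 h3
        rw [RingHom.id_apply, h2, Pi.smul_apply, h3]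
        simp only [h1, Pi.smul_apply, smul_eq_mul, mul_left_comm] }
    ‖W‖ fun u => by
      refine Lp.norm_le_mul_norm_of_ae_le_mul ?_
      filter_upwards [MemLp.coeFn_toLp (memLp_mul W u)]
        with x h
      simp only [LinearMap.coe_mk, AddHom.coe_mk]
      rw [h, norm_mul]
      exact mul_le_mul_of_nonneg_right (W.norm_coe_le_norm x) (norm_nonneg _)

theorem coeFn_mulL2 {d : ℕ} (W : Space d →ᵇ ℝ) (u : RealL2 d) :
    mulL2 W u =ᵐ[volume] fun x => W x * u x :=
  MemLp.coeFn_toLp (memLp_mul W u)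

theorem inner_mulL2_left {d : ℕ} (W : Space d →ᵇ ℝ) (u v : RealL2 d) :
    inner ℝ (mulL2 W u) v = inner ℝ u (mulL2 W v) := by
  rw [inner_eq_integral (coeFn_mulL2 W u) EventuallyEq.rfl,
    inner_eq_integral EventuallyEq.rfl (coeFn_mulL2 W v)]
  exact integral_congr_ae (.of_forall fun x => by ring)

/-- If `-Δ + W` annihilates a positive function then it is a nonnegative operator on `L²`. -/
theorem HasWeakLaplacian.schrodinger_nonneg {d : ℕ} {φ : Space d → ℝ} {W : Space d →ᵇ ℝ}
    (hφ : ContDiff ℝ 2 φ) (hpos : ∀ x, 0 < φ x) (hW : ∀ x, (Δ φ) x = W x * φ x)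
    {u g : RealL2 d} (h : HasWeakLaplacian u g) : 0 ≤ inner ℝ u (mulL2 W u - g) := by
  let e := EuclideanSpace.basisFun (Fin d) ℝ
  -- Remove the cut-off from the test functions.
  have schwartz : ∀ a : 𝓢(Space d, ℝ), 0 ≤ inner ℝ (toL2 a) (mulL2 W (toL2 a) - toL2 (Δ a)) := by
    intro a
    obtain ⟨θ, G, hc, hG, h0, l0, -, -, h1, l1⟩ := exists_compactSupport_approx e a
    have hsq : ∀ (b : ℕ → 𝓢(Space d, ℝ)) (c : 𝓢(Space d, ℝ)) (K : Space d →ᵇ ℝ),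
        (∀ n x, |b n x| ≤ G x) → (∀ x, Tendsto (fun n => b n x) atTop (𝓝 (c x))) →
        Tendsto (fun n => ∫ x, K x * b n x ^ 2) atTop (𝓝 (∫ x, K x * c x ^ 2)) := by
      intro b c K hb hl
      refine tendsto_integral_of_dominated_convergence (fun x => ‖K‖ * G x ^ 2)
        (fun n => (K.continuous.mul ((b n).continuous.pow 2)).aestronglyMeasurable)
        (hG.integrable_sq.const_mul _) (fun n => .of_forall fun x => ?_)
        (.of_forall fun x => ((hl x).pow 2).const_mul _)
      rw [norm_mul, norm_pow]
      gcongr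
      · exact K.norm_coe_le_norm x
      · exact hb n x
    have hgrad : ∀ i, Tendsto (fun n => ∫ x, (∂_{e i} (θ n)) x ^ 2) atTop
        (𝓝 (∫ x, (∂_{e i} a) x ^ 2)) := fun i => by
      simpa using hsq (fun n => ∂_{e i} (θ n)) (∂_{e i} a) 1 (h1 i) (l1 i)
    have hlim := (tendsto_finsetSum Finset.univ fun i _ => hgrad i).add (hsq θ a W h0 l0)
    have hnn := ge_of_tendsto' hlim fun n =>
      dirichlet_form_nonneg_of_compactSupport e hφ hpos hW (θ n) (hc n)
    have hmul : mulL2 W (toL2 a) =ᵐ[volume] fun x => W x * a x := by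
      filter_upwards [coeFn_mulL2 W (toL2 a), coeFn_toL2 a] with x h1 h2
      rw [h1, h2]
    rw [inner_sub_right, inner_laplacian_self e, inner_eq_integral (coeFn_toL2 a) hmul,
      sub_neg_eq_add, add_comm]
    have hint : ∀ x, a x * (W x * a x) = W x * a x ^ 2 := fun x => by ring
    simpa only [hint] using hnn
  obtain ⟨a, l1, l2⟩ := h.exists_schwartz_approx
  exact ge_of_tendsto' (l1.inner ((((mulL2 W).continuous.tendsto u).comp l1).sub l2))
    fun n => schwartz (a n)

/-! ### Real and imaginary parts of `H²` functions -/

/-- The real part of a complex `L²` function. -/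
noncomputable def reL2 {d : ℕ} : L2 d →L[ℝ] RealL2 d := Complex.reCLM.compLpL 2 volume

/-- The imaginary part of a complex `L²` function. -/
noncomputable def imL2 {d : ℕ} : L2 d →L[ℝ] RealL2 d := Complex.imCLM.compLpL 2 volume

theorem coeFn_reL2 {d : ℕ} (u : L2 d) : reL2 u =ᵐ[volume] fun x => (u x).re :=
  ContinuousLinearMap.coeFn_compLp Complex.reCLM u

theorem coeFn_imL2 {d : ℕ} (u : L2 d) : imL2 u =ᵐ[volume] fun x => (u x).im :=
  ContinuousLinearMap.coeFn_compLp Complex.imCLM u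

theorem coeFn_toComplex {d : ℕ} (u : RealL2 d) : toComplex u =ᵐ[volume] fun x => (u x : ℂ) :=
  ContinuousLinearMap.coeFn_compLp Complex.ofRealCLM u

theorem toComplex_add {d : ℕ} (u w : RealL2 d) :
    toComplex (u + w) = toComplex u + toComplex w :=
  map_add (Complex.ofRealCLM.compLpL 2 volume) u w

theorem toComplex_smul {d : ℕ} (c : ℝ) (u : RealL2 d) :
    toComplex (c • u) = (c : ℂ) • toComplex u := by
  rw [Complex.coe_smul]
  exact map_smul (Complex.ofRealCLM.compLpL 2 volume) c u

@[simp]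
theorem reL2_toComplex {d : ℕ} (u : RealL2 d) : reL2 (toComplex u) = u := by
  ext1
  filter_upwards [coeFn_reL2 (toComplex u), coeFn_toComplex u] with x h1 h2
  rw [h1, h2, Complex.ofReal_re]

@[simp]
theorem imL2_toComplex {d : ℕ} (u : RealL2 d) : imL2 (toComplex u) = 0 := by
  ext1
  filter_upwards [coeFn_imL2 (toComplex u), coeFn_toComplex u,
    Lp.coeFn_zero ℝ 2 (volume : Measure (Space d))] with x h1 h2 h3
  rw [h1, h2, h3, Complex.ofReal_im, Pi.zero_apply]

@[simp]
theorem reL2_I_smul {d : ℕ} (u : L2 d) : reL2 (Complex.I • u) = -imL2 u := by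
  ext1
  filter_upwards [coeFn_reL2 (Complex.I • u), Lp.coeFn_smul Complex.I u, coeFn_imL2 u,
    Lp.coeFn_neg (imL2 u)] with x h1 h2 h3 h4
  rw [h1, h2, h4, Pi.neg_apply, h3]
  simp

@[simp]
theorem imL2_I_smul {d : ℕ} (u : L2 d) : imL2 (Complex.I • u) = reL2 u := by
  ext1
  filter_upwards [coeFn_imL2 (Complex.I • u), Lp.coeFn_smul Complex.I u, coeFn_reL2 u]
    with x h1 h2 h3
  rw [h1, h2, h3]
  simp

theorem re_add_I_smul_im {d : ℕ} (u : L2 d) :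
    toComplex (reL2 u) + Complex.I • toComplex (imL2 u) = u := by
  ext1
  filter_upwards [Lp.coeFn_add (toComplex (reL2 u)) (Complex.I • toComplex (imL2 u)),
    Lp.coeFn_smul Complex.I (toComplex (imL2 u)), coeFn_toComplex (reL2 u),
    coeFn_toComplex (imL2 u), coeFn_reL2 u, coeFn_imL2 u] with x h1 h2 h3 h4 h5 h6
  rw [h1, Pi.add_apply, h2, Pi.smul_apply, h3, h4, h5, h6, smul_eq_mul, mul_comm]
  exact Complex.re_add_im _

theorem ext_re_im {d : ℕ} {u w : L2 d} (h1 : reL2 u = reL2 w) (h2 : imL2 u = imL2 w) : u = w := by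
  rw [← re_add_I_smul_im u, h1, h2, re_add_I_smul_im]

theorem reL2_smul_ofReal {d : ℕ} (c : ℝ) (u : L2 d) : reL2 ((c : ℂ) • u) = c • reL2 u := by
  rw [Complex.coe_smul, map_smul]

theorem imL2_smul_ofReal {d : ℕ} (c : ℝ) (u : L2 d) : imL2 ((c : ℂ) • u) = c • imL2 u := by
  rw [Complex.coe_smul, map_smul]

/-- A function whose distributional Laplacian is in `L²` belongs to `H²`. -/
theorem exists_laplacianH2_eq_iff {d : ℕ} {u g : L2 d} :
    (∃ h : u ∈ H2 d, laplacianH2 d ⟨u, h⟩ = g) ↔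
      (g : 𝓢'(Space d, ℂ)) = Δ (u : 𝓢'(Space d, ℂ)) := by
  constructor
  · rintro ⟨h, rfl⟩
    exact laplacianH2_spec ⟨u, h⟩
  · intro h
    have hu : u ∈ H2 d := by
      refine ⟨u - (resolventScale : ℂ) • g, ?_⟩
      rw [← Lp.toTemperedDistributionCLM_apply (u - _), map_sub, map_smul,
        Lp.toTemperedDistributionCLM_apply, Lp.toTemperedDistributionCLM_apply, h,
        TemperedDistribution.laplacian_eq_fourierMultiplierCLM,
        TemperedDistribution.besselPotential, Complex.coe_smul, smul_smul]
      have hs : resolventScale * -(2 * Real.pi) ^ 2 = -1 := by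
        unfold resolventScale
        field_simp
      rw [hs, neg_one_smul, sub_neg_eq_add]
      have hq : (fun x : Space d => ((‖x‖ ^ 2 : ℝ) : ℂ)).HasTemperateGrowth := by fun_prop
      have h1 : (fun x : Space d => (((1 + ‖x‖ ^ 2) ^ ((2 : ℝ) / 2) : ℝ) : ℂ)) =
          (fun _ => 1) + fun x : Space d => ((‖x‖ ^ 2 : ℝ) : ℂ) := by
        ext x
        simp
      rw [h1, TemperedDistribution.fourierMultiplierCLM_apply,
        TemperedDistribution.smulLeftCLM_add (by fun_prop) hq]
      simp only [add_apply, TemperedDistribution.smulLeftCLM_const, one_smul,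
        FourierTransform.fourierInv_add, FourierTransform.fourierInv_fourier_eq]
      rw [TemperedDistribution.fourierMultiplierCLM_apply]
    exact ⟨hu, toTemperedDistribution_injective ((laplacianH2_spec ⟨u, hu⟩).trans h.symm)⟩

theorem integrable_schwartz_smul {d : ℕ} (u : L2 d) (ψ : 𝓢(Space d, ℂ)) :
    Integrable fun x => ψ x • u x :=
  (ψ.memLp 2).integrable_mul (Lp.memLp u)

theorem re_integral_schwartz_smul {d : ℕ} (u : L2 d) (ψ : 𝓢(Space d, ℂ)) :
    (∫ x, ψ x • u x).re =
      inner ℝ (reL2 u) (toL2 (SchwartzMap.postcompCLM Complex.reCLM ψ)) -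
      inner ℝ (imL2 u) (toL2 (SchwartzMap.postcompCLM Complex.imCLM ψ)) := by
  rw [inner_eq_integral EventuallyEq.rfl (coeFn_toL2 _),
    inner_eq_integral EventuallyEq.rfl (coeFn_toL2 _),
    ← integral_sub (integrable_mul_schwartz _ _) (integrable_mul_schwartz _ _)]
  refine (Complex.reCLM.integral_comp_comm (integrable_schwartz_smul u ψ)).symm.trans ?_
  refine integral_congr_ae ?_
  filter_upwards [coeFn_reL2 u, coeFn_imL2 u] with x h1 h2
  simp [h1, h2]
  ring

theorem im_integral_schwartz_smul {d : ℕ} (u : L2 d) (ψ : 𝓢(Space d, ℂ)) :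
    (∫ x, ψ x • u x).im =
      inner ℝ (imL2 u) (toL2 (SchwartzMap.postcompCLM Complex.reCLM ψ)) +
      inner ℝ (reL2 u) (toL2 (SchwartzMap.postcompCLM Complex.imCLM ψ)) := by
  rw [inner_eq_integral EventuallyEq.rfl (coeFn_toL2 _),
    inner_eq_integral EventuallyEq.rfl (coeFn_toL2 _),
    ← integral_add (integrable_mul_schwartz _ _) (integrable_mul_schwartz _ _)]
  refine (Complex.imCLM.integral_comp_comm (integrable_schwartz_smul u ψ)).symm.trans ?_
  refine integral_congr_ae ?_
  filter_upwards [coeFn_reL2 u, coeFn_imL2 u] with x h1 h2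
  simp [h1, h2]
  ring

/-- The Laplacian on `H²(ℝ^d, ℂ)` acts separately on real and imaginary parts. -/
theorem exists_laplacianH2_eq_iff_re_im {d : ℕ} {u g : L2 d} :
    (∃ h : u ∈ H2 d, laplacianH2 d ⟨u, h⟩ = g) ↔
      HasWeakLaplacian (reL2 u) (reL2 g) ∧ HasWeakLaplacian (imL2 u) (imL2 g) := by
  have htest : (g : 𝓢'(Space d, ℂ)) = Δ (u : 𝓢'(Space d, ℂ)) ↔
      ∀ ψ : 𝓢(Space d, ℂ), ∫ x, (Δ ψ) x • u x = ∫ x, ψ x • g x := by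
    constructor
    · intro h ψ
      have := congrArg (fun T : 𝓢'(Space d, ℂ) => T ψ) h
      simpa only [TemperedDistribution.laplacian_apply_apply, Lp.toTemperedDistribution_apply]
        using this.symm
    · intro h
      ext ψ
      rw [TemperedDistribution.laplacian_apply_apply, Lp.toTemperedDistribution_apply,
        Lp.toTemperedDistribution_apply, h]
  rw [exists_laplacianH2_eq_iff, htest]
  constructor
  · intro h
    have hre : ∀ ψ : 𝓢(Space d, ℝ), SchwartzMap.postcompCLM Complex.reCLM
        (SchwartzMap.postcompCLM Complex.ofRealCLM ψ) = ψ := fun ψ => by ext x; simp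
    have him : ∀ ψ : 𝓢(Space d, ℝ), SchwartzMap.postcompCLM Complex.imCLM
        (SchwartzMap.postcompCLM Complex.ofRealCLM ψ) = 0 := fun ψ => by ext x; simp
    refine ⟨fun ψ => ?_, fun ψ => ?_⟩
    · have := congrArg Complex.re (h (SchwartzMap.postcompCLM Complex.ofRealCLM ψ))
      simpa only [re_integral_schwartz_smul, laplacian_postcomp, hre, him, map_zero,
        inner_zero_right, sub_zero] using this
    · have := congrArg Complex.im (h (SchwartzMap.postcompCLM Complex.ofRealCLM ψ))
      simpa only [im_integral_schwartz_smul, laplacian_postcomp, hre, him, map_zero,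
        inner_zero_right, add_zero] using this
  · rintro ⟨h1, h2⟩ ψ
    apply Complex.ext
    · rw [re_integral_schwartz_smul, re_integral_schwartz_smul, ← laplacian_postcomp,
        ← laplacian_postcomp, h1, h2]
    · rw [im_integral_schwartz_smul, im_integral_schwartz_smul, ← laplacian_postcomp,
        ← laplacian_postcomp, h1, h2]

/-! ### The nonlinear coefficients -/

theorem IsAdmissibleNonlinearity.continuousOn_deriv {f : ℝ → ℝ} (hf : IsAdmissibleNonlinearity f) :
    ContinuousOn (deriv f) (Ioi 0) :=
  (hf.smooth.mono Ioi_subset_Ici_self).continuousOn_deriv_of_isOpen isOpen_Ioi (by simp)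

theorem IsAdmissibleNonlinearity.hasDerivAt {f : ℝ → ℝ} (hf : IsAdmissibleNonlinearity f)
    {t : ℝ} (ht : 0 < t) : HasDerivAt f (deriv f t) t :=
  ((hf.smooth.contDiffAt (Ici_mem_nhds ht)).differentiableAt (by simp)).hasDerivAt

/-- Smoothness up to the endpoint `0` bounds `f` and `f'` on bounded subsets of `(0, ∞)`. -/
theorem IsAdmissibleNonlinearity.exists_bound {f : ℝ → ℝ} (hf : IsAdmissibleNonlinearity f)
    (M : ℝ) : ∃ C, ∀ t, 0 < t → t ≤ M → |f t| ≤ C ∧ |deriv f t| ≤ C := by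
  have h1 : ContinuousOn f (Icc 0 M) := hf.smooth.continuousOn.mono Icc_subset_Ici_self
  have h2 : ContinuousOn (derivWithin f (Ici 0)) (Icc 0 M) :=
    (hf.smooth.continuousOn_derivWithin (uniqueDiffOn_Ici 0) (by simp)).mono Icc_subset_Ici_self
  obtain ⟨A, hA⟩ := isCompact_Icc.exists_bound_of_continuousOn h1
  obtain ⟨B, hB⟩ := isCompact_Icc.exists_bound_of_continuousOn h2
  refine ⟨max A B, fun t h0 ht => ⟨(hA t ⟨h0.le, ht⟩).trans (le_max_left _ _), ?_⟩⟩
  rw [← derivWithin_of_mem_nhds (Ici_mem_nhds h0)]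
  exact (hB t ⟨h0.le, ht⟩).trans (le_max_right _ _)

section Branch

variable {d : ℕ} {V : Space d → ℝ} {f : ℝ → ℝ} {I : Set ℝ} {φ : ℝ → Space d → ℝ} {lam : ℝ}

theorem IsAdmissiblePotential.exists_bound (hV : IsAdmissiblePotential V) :
    ∃ C, ∀ x, |V x| ≤ C := by
  obtain ⟨C, a, ha, h⟩ := hV.decay
  refine ⟨|C|, fun x => (h x).trans ?_⟩
  refine (mul_le_mul_of_nonneg_right (le_abs_self C) (Real.exp_pos _).le).trans ?_
  refine mul_le_of_le_one_right (abs_nonneg C) (Real.exp_le_one_iff.mpr ?_)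
  nlinarith [norm_nonneg x]

theorem IsGroundStateBranch.exists_sq_bound (hφ : IsGroundStateBranch V f I φ) (hlam : lam ∈ I) :
    ∃ M, 0 ≤ M ∧ ∀ x, φ lam x ^ 2 ≤ M := by
  obtain ⟨C, hC⟩ := hφ.bounded lam hlam
  exact ⟨C ^ 2, sq_nonneg C, fun x => pow_le_pow_left₀ (hφ.pos lam hlam x).le (hC x) 2⟩

/-- The potential of `L₋` is a bounded continuous function. -/
theorem IsGroundStateBranch.exists_potential (hV : IsAdmissiblePotential V)
    (hf : IsAdmissibleNonlinearity f) (hφ : IsGroundStateBranch V f I φ) (hlam : lam ∈ I) :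
    ∃ W : Space d →ᵇ ℝ, ∀ x, W x = lam + V x - f (φ lam x ^ 2) := by
  obtain ⟨M, -, hM⟩ := hφ.exists_sq_bound hlam
  obtain ⟨A, hA⟩ := hf.exists_bound M
  obtain ⟨B, hB⟩ := hV.exists_bound
  have hc : Continuous fun x => f (φ lam x ^ 2) :=
    hf.smooth.continuousOn.comp_continuous ((hφ.contDiff lam hlam).continuous.pow 2)
      fun x => mem_Ici.mpr (sq_nonneg _)
  refine ⟨.ofNormedAddCommGroup (fun x => lam + V x - f (φ lam x ^ 2))
    ((hV.smooth.continuous.const_add lam).sub hc) (|lam| + B + A) fun x => ?_, fun x => rfl⟩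
  exact (abs_sub _ _).trans (add_le_add ((abs_add_le _ _).trans (add_le_add le_rfl (hB x)))
    (hA _ (pow_pos (hφ.pos lam hlam x) 2) (hM x)).1)

/-- Half of the difference of the potentials of `L₋` and `L₊` is a bounded continuous function. -/
theorem IsGroundStateBranch.exists_coupling (hf : IsAdmissibleNonlinearity f)
    (hφ : IsGroundStateBranch V f I φ) (hlam : lam ∈ I) :
    ∃ P : Space d →ᵇ ℝ, ∀ x, P x = deriv f (φ lam x ^ 2) * φ lam x ^ 2 := by
  obtain ⟨M, hM0, hM⟩ := hφ.exists_sq_bound hlam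
  obtain ⟨A, hA⟩ := hf.exists_bound M
  have hsq : Continuous fun x => φ lam x ^ 2 := (hφ.contDiff lam hlam).continuous.pow 2
  have hc : Continuous fun x => deriv f (φ lam x ^ 2) :=
    hf.continuousOn_deriv.comp_continuous hsq fun x => pow_pos (hφ.pos lam hlam x) 2
  refine ⟨.ofNormedAddCommGroup (fun x => deriv f (φ lam x ^ 2) * φ lam x ^ 2)
    (hc.mul hsq) (A * M) fun x => ?_, fun x => rfl⟩
  have h := (hA _ (pow_pos (hφ.pos lam hlam x) 2) (hM x)).2
  rw [norm_mul, Real.norm_eq_abs, Real.norm_of_nonneg (sq_nonneg _)]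
  exact mul_le_mul h (hM x) (sq_nonneg _) ((abs_nonneg _).trans h)

theorem IsGroundStateBranch.laplacian_eq (hφ : IsGroundStateBranch V f I φ) (hlam : lam ∈ I)
    (x : Space d) : (Δ (φ lam)) x = (lam + V x - f (φ lam x ^ 2)) * φ lam x := by
  linarith [hφ.equation lam hlam x]

/-! ### Differentiation of the equation along the branch -/

/-- Differentiation under the integral against a compactly supported function; compactness supplies
the uniform bound on the derivative. -/
theorem hasDerivAt_integral_mul {k k' : ℝ → Space d → ℝ} (hI : IsOpen I)
    (hk : ContinuousOn (fun p : ℝ × Space d => k p.1 p.2) (I ×ˢ univ))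
    (hk' : ContinuousOn (fun p : ℝ × Space d => k' p.1 p.2) (I ×ˢ univ))
    (hderiv : ∀ μ ∈ I, ∀ x, HasDerivAt (fun ν => k ν x) (k' μ x) μ)
    {θ : Space d → ℝ} (hθ : Continuous θ) (hc : HasCompactSupport θ) (hlam : lam ∈ I) :
    HasDerivAt (fun μ => ∫ x, k μ x * θ x) (∫ x, k' lam x * θ x) lam := by
  obtain ⟨ε, hε, hball⟩ := Metric.nhds_basis_closedBall.mem_iff.mp (hI.mem_nhds hlam)
  have slice : ∀ h : ℝ → Space d → ℝ,
      ContinuousOn (fun p : ℝ × Space d => h p.1 p.2) (I ×ˢ univ) → ∀ μ ∈ I,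
      Integrable fun x => h μ x * θ x := fun h hh μ hμ =>
    ((hh.comp_continuous (f := fun x => (μ, x)) (by fun_prop) fun x => ⟨hμ, trivial⟩).mul
      hθ).integrable_of_hasCompactSupport hc.mul_left
  obtain ⟨C, hC⟩ := ((isCompact_closedBall lam ε).prod hc).exists_bound_of_continuousOn
    (hk'.mono (prod_mono hball (subset_univ _)))
  refine (hasDerivAt_integral_of_dominated_loc_of_deriv_le
    (F := fun μ x => k μ x * θ x) (F' := fun μ x => k' μ x * θ x) (bound := fun x => C * |θ x|)
    (Metric.closedBall_mem_nhds lam hε) ?_ (slice k hk lam hlam)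
    (slice k' hk' lam hlam).aestronglyMeasurable (.of_forall fun x μ hμ => ?_) ?_
    (.of_forall fun x μ hμ => ?_)).2
  · filter_upwards [hI.mem_nhds hlam] with μ hμ
    exact (slice k hk μ hμ).aestronglyMeasurable
  · rw [norm_mul, Real.norm_eq_abs (θ x)]
    by_cases hx : x ∈ tsupport θ
    · exact mul_le_mul_of_nonneg_right (hC (μ, x) ⟨hμ, hx⟩) (abs_nonneg _)
    · simp [image_eq_zero_of_notMem_tsupport hx]
  · exact (continuous_const.mul hθ.abs).integrable_of_hasCompactSupport
      (HasCompactSupport.mul_left (hc.comp_left (g := fun t : ℝ => |t|) abs_zero))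
  · exact (hderiv μ (hball hμ) x).mul_const _

/-- The element of `L²` given by a ground state. -/
noncomputable def IsGroundStateBranch.state (hφ : IsGroundStateBranch V f I φ) (hlam : lam ∈ I) :
    RealL2 d := (hφ.memLp lam hlam).toLp

/-- The element of `L²` given by the derivative of the branch of ground states. -/
noncomputable def IsGroundStateBranch.tangent (hφ : IsGroundStateBranch V f I φ)
    (hlam : lam ∈ I) : RealL2 d := (hφ.memLp_deriv_param lam hlam).toLp

theorem IsGroundStateBranch.coeFn_state (hφ : IsGroundStateBranch V f I φ) (hlam : lam ∈ I) :
    hφ.state hlam =ᵐ[volume] φ lam := MemLp.coeFn_toLp _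

theorem IsGroundStateBranch.coeFn_tangent (hφ : IsGroundStateBranch V f I φ) (hlam : lam ∈ I) :
    hφ.tangent hlam =ᵐ[volume] fun x => deriv (fun μ => φ μ x) lam := MemLp.coeFn_toLp _

/-- `L₋ φ = 0`. -/
theorem IsGroundStateBranch.hasWeakLaplacian_state (hφ : IsGroundStateBranch V f I φ)
    (hlam : lam ∈ I) {W : Space d →ᵇ ℝ} (hW : ∀ x, W x = lam + V x - f (φ lam x ^ 2)) :
    HasWeakLaplacian (hφ.state hlam) (mulL2 W (hφ.state hlam)) := by
  refine hasWeakLaplacian_of_compactSupport fun ψ hψ => ?_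
  have h := integral_mul_laplacian_comm (hφ.contDiff lam hlam) ψ hψ
  simp_rw [hφ.laplacian_eq hlam, ← hW] at h
  refine (integral_congr_ae ?_).trans (h.trans (integral_congr_ae ?_))
  · filter_upwards [hφ.coeFn_state hlam] with x h1
    rw [h1]
  · filter_upwards [hφ.coeFn_state hlam, coeFn_mulL2 W (hφ.state hlam)] with x h1 h2
    rw [h2, h1]

/-- `L₊ ∂φ/∂lam = -φ`: the weak form of the ground state equation, differentiated in `lam`. -/
theorem IsGroundStateBranch.hasWeakLaplacian_tangent (hV : IsAdmissiblePotential V)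
    (hf : IsAdmissibleNonlinearity f) (hφ : IsGroundStateBranch V f I φ) (hlam : lam ∈ I)
    {W : Space d →ᵇ ℝ}
    (hW : ∀ x, W x = lam + V x - f (φ lam x ^ 2) - 2 * (deriv f (φ lam x ^ 2) * φ lam x ^ 2)) :
    HasWeakLaplacian (hφ.tangent hlam) (hφ.state hlam + mulL2 W (hφ.tangent hlam)) := by
  have hopen : IsOpen (I ×ˢ (univ : Set (Space d))) := hφ.isOpen.prod isOpen_univ
  have hdiff : ∀ μ ∈ I, ∀ x, HasDerivAt (fun ν => φ ν x)
      (fderiv ℝ (fun p : ℝ × Space d => φ p.1 p.2) (μ, x) (1, 0)) μ := by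
    intro μ hμ x
    have h1 := ((hφ.contDiffOn_param.contDiffAt (hopen.mem_nhds (x := (μ, x))
      ⟨hμ, trivial⟩)).differentiableAt (by norm_num)).hasFDerivAt
    have h2 : HasDerivAt (fun ν : ℝ => (ν, x)) (1, 0) μ :=
      (hasDerivAt_id μ).prodMk (hasDerivAt_const μ x)
    exact h1.comp_hasDerivAt μ h2
  have hderiv : ∀ μ ∈ I, ∀ x, HasDerivAt (fun ν => φ ν x) (deriv (fun ν => φ ν x) μ) μ :=
    fun μ hμ x => (hdiff μ hμ x).differentiableAt.hasDerivAt
  have hc : ContinuousOn (fun p : ℝ × Space d => φ p.1 p.2) (I ×ˢ univ) :=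
    hφ.contDiffOn_param.continuousOn
  have hc' : ContinuousOn (fun p : ℝ × Space d => deriv (fun ν => φ ν p.2) p.1) (I ×ˢ univ) :=
    ((hφ.contDiffOn_param.continuousOn_fderiv_of_isOpen hopen le_rfl).clm_apply
      continuousOn_const).congr fun p hp => (hdiff p.1 hp.1 p.2).deriv
  have hfc : ContinuousOn (fun p : ℝ × Space d => f (φ p.1 p.2 ^ 2)) (I ×ˢ univ) :=
    hf.smooth.continuousOn.comp (hc.pow 2) fun p _ => mem_Ici.mpr (sq_nonneg _)
  have hfc' : ContinuousOn (fun p : ℝ × Space d => deriv f (φ p.1 p.2 ^ 2)) (I ×ˢ univ) :=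
    hf.continuousOn_deriv.comp (hc.pow 2) fun p hp => pow_pos (hφ.pos p.1 hp.1 p.2) 2
  have hVc : ContinuousOn (fun p : ℝ × Space d => p.1 + V p.2) (I ×ˢ univ) :=
    (continuous_fst.add (hV.smooth.continuous.comp continuous_snd)).continuousOn
  have hnl : ∀ μ ∈ I, ∀ x, HasDerivAt (fun ν => (ν + V x - f (φ ν x ^ 2)) * φ ν x)
      ((1 - deriv f (φ μ x ^ 2) * (2 * φ μ x * deriv (fun ν => φ ν x) μ)) * φ μ x +
        (μ + V x - f (φ μ x ^ 2)) * deriv (fun ν => φ ν x) μ) μ := by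
    intro μ hμ x
    have h1 := (hderiv μ hμ x).fun_pow 2
    have h2 := (hf.hasDerivAt (pow_pos (hφ.pos μ hμ x) 2)).comp μ h1
    have h3 := (((hasDerivAt_id μ).add_const (V x)).sub h2).mul (hderiv μ hμ x)
    refine h3.congr_deriv ?_
    simp
  refine hasWeakLaplacian_of_compactSupport fun ψ hψ => ?_
  have hΔ : HasCompactSupport (Δ ψ : 𝓢(Space d, ℝ)) := by
    refine hψ.of_isClosed_subset (isClosed_tsupport _) (closure_minimal ?_ (isClosed_tsupport _))
    intro x hx
    contrapose! hx
    rw [Function.notMem_support, SchwartzMap.laplacian_apply]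
    rw [notMem_tsupport_iff_eventuallyEq] at hx
    rw [(InnerProductSpace.laplacian_congr_nhds hx).eq_of_nhds]
    exact congrFun InnerProductSpace.laplacian_const x
  have hleft := hasDerivAt_integral_mul (k := φ) (k' := fun μ x => deriv (fun ν => φ ν x) μ)
    hφ.isOpen hc hc' hderiv (Δ ψ).continuous hΔ hlam
  have hright := hasDerivAt_integral_mul (k := fun ν x => (ν + V x - f (φ ν x ^ 2)) * φ ν x)
    (k' := fun μ x =>
      (1 - deriv f (φ μ x ^ 2) * (2 * φ μ x * deriv (fun ν => φ ν x) μ)) * φ μ x +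
        (μ + V x - f (φ μ x ^ 2)) * deriv (fun ν => φ ν x) μ)
    hφ.isOpen ((hVc.sub hfc).mul hc)
    (((continuousOn_const.sub (hfc'.mul ((continuousOn_const.mul hc).mul hc'))).mul hc).add
      ((hVc.sub hfc).mul hc')) hnl ψ.continuous hψ hlam
  have heq : (fun μ => ∫ x, φ μ x * (Δ ψ) x) =ᶠ[𝓝 lam]
      fun μ => ∫ x, ((μ + V x - f (φ μ x ^ 2)) * φ μ x) * ψ x := by
    filter_upwards [hφ.isOpen.mem_nhds hlam] with μ hμ
    rw [integral_mul_laplacian_comm (hφ.contDiff μ hμ) ψ hψ]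
    simp_rw [hφ.laplacian_eq hμ]
  -- Both sides of the weak equation have been differentiated; the derivatives agree.
  have h := hleft.unique (hright.congr_of_eventuallyEq heq)
  refine (integral_congr_ae ?_).trans (h.trans (integral_congr_ae ?_))
  · filter_upwards [hφ.coeFn_tangent hlam] with x h1
    rw [h1]
  · filter_upwards [hφ.coeFn_tangent hlam, hφ.coeFn_state hlam,
      coeFn_mulL2 W (hφ.tangent hlam), Lp.coeFn_add (hφ.state hlam)
      (mulL2 W (hφ.tangent hlam))] with x h1 h2 h3 h4
    rw [h4, Pi.add_apply, h3, h1, h2, hW]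
    ring

end Branch

/-! ### The eigenvalue problem for real functions -/

theorem mem_multDomain {d : ℕ} (W : Space d →ᵇ ℝ) (u : L2 d) : u ∈ multDomain (d := d) W := by
  have h : MemLp (fun x => (W x : ℂ)) ⊤ volume := W.memLp_top.ofReal
  exact (Lp.memLp u).mul h

theorem reL2_mult {d : ℕ} (W : Space d →ᵇ ℝ) (u : multDomain (d := d) W) :
    reL2 (mult (d := d) W u) = mulL2 W (reL2 u) := by
  ext1
  filter_upwards [coeFn_reL2 (mult (d := d) W u), MemLp.coeFn_toLp u.2,
    coeFn_mulL2 W (reL2 (u : L2 d)), coeFn_reL2 (u : L2 d)] with x h1 h2 h3 h4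
  rw [h1, h3, h4]
  refine (congrArg Complex.re h2).trans ?_
  simp

theorem imL2_mult {d : ℕ} (W : Space d →ᵇ ℝ) (u : multDomain (d := d) W) :
    imL2 (mult (d := d) W u) = mulL2 W (imL2 u) := by
  ext1
  filter_upwards [coeFn_imL2 (mult (d := d) W u), MemLp.coeFn_toLp u.2,
    coeFn_mulL2 W (imL2 (u : L2 d)), coeFn_imL2 (u : L2 d)] with x h1 h2 h3 h4
  rw [h1, h3, h4]
  refine (congrArg Complex.im h2).trans ?_
  simp

/-- `(-Δ + W) u = g` splits into equations for the real and imaginary parts. -/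
theorem exists_schrodinger_eq_iff {d : ℕ} (W : Space d →ᵇ ℝ) {u g : L2 d} {a b : RealL2 d}
    (ha : reL2 g = a) (hb : imL2 g = b) :
    (∃ h : u ∈ (schrodinger (d := d) W).domain, schrodinger (d := d) W ⟨u, h⟩ = g) ↔
      HasWeakLaplacian (reL2 u) (mulL2 W (reL2 u) - a) ∧
      HasWeakLaplacian (imL2 u) (mulL2 W (imL2 u) - b) := by
  subst ha hb
  let u' : multDomain (d := d) W := ⟨u, mem_multDomain W u⟩
  have hre : mulL2 W (reL2 u) - reL2 g = reL2 (mult (d := d) W u' - g) := by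
    rw [map_sub, reL2_mult]
  have him : mulL2 W (imL2 u) - imL2 g = imL2 (mult (d := d) W u' - g) := by
    rw [map_sub, imL2_mult]
  rw [hre, him, ← exists_laplacianH2_eq_iff_re_im]
  constructor
  · rintro ⟨h, rfl⟩
    refine ⟨h.1, ?_⟩
    change _ = _ - (-laplacianH2 d ⟨u, h.1⟩ + mult (d := d) W u')
    abel
  · rintro ⟨h, hg⟩
    refine ⟨⟨h, mem_multDomain W u⟩, ?_⟩
    change -laplacianH2 d ⟨u, h⟩ + mult (d := d) W u' = g
    rw [hg]
    abel

/-- The pairs `(ξ, η)` of real functions with `(-Δ + K) ξ = E η` and `(-Δ + W) η = E ξ`. -/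
def realModes {d : ℕ} (W K : Space d →ᵇ ℝ) (E : ℝ) : Submodule ℝ (RealL2 d × RealL2 d) where
  carrier := {p | HasWeakLaplacian p.1 (mulL2 K p.1 - E • p.2) ∧
    HasWeakLaplacian p.2 (mulL2 W p.2 - E • p.1)}
  add_mem' := by
    rintro p q ⟨h1, h2⟩ ⟨h3, h4⟩
    constructor
    · change HasWeakLaplacian (p.1 + q.1) (mulL2 K (p.1 + q.1) - E • (p.2 + q.2))
      rw [map_add, smul_add, add_sub_add_comm]
      exact h1.add h3
    · change HasWeakLaplacian (p.2 + q.2) (mulL2 W (p.2 + q.2) - E • (p.1 + q.1))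
      rw [map_add, smul_add, add_sub_add_comm]
      exact h2.add h4
  zero_mem' := by
    constructor <;> intro ψ <;> simp
  smul_mem' := by
    rintro c p ⟨h1, h2⟩
    constructor
    · change HasWeakLaplacian (c • p.1) (mulL2 K (c • p.1) - E • c • p.2)
      rw [map_smul, smul_comm E, ← smul_sub]
      exact h1.smul c
    · change HasWeakLaplacian (c • p.2) (mulL2 W (c • p.2) - E • c • p.1)
      rw [map_smul, smul_comm E, ← smul_sub]
      exact h2.smul c

theorem hasWeakLaplacian_neg_iff {d : ℕ} {u g : RealL2 d} :
    HasWeakLaplacian (-u) (-g) ↔ HasWeakLaplacian u g := by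
  refine forall_congr' fun ψ => ?_
  rw [inner_neg_left, inner_neg_left, neg_inj]

/-- The equations for `(a + i b, r + i s)` separate into two pairs of real modes. -/
theorem realModes_pair_iff {d : ℕ} {W K : Space d →ᵇ ℝ} {E : ℝ} (a b r s : RealL2 d) :
    ((HasWeakLaplacian a (mulL2 K a - E • s) ∧ HasWeakLaplacian b (mulL2 K b - -(E • r))) ∧
      (HasWeakLaplacian r (mulL2 W r - -(E • b)) ∧ HasWeakLaplacian s (mulL2 W s - E • a))) ↔
      (a, s) ∈ realModes W K E ∧ (b, -r) ∈ realModes W K E := by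
  have hneg : HasWeakLaplacian (-r) (mulL2 W (-r) - E • b) ↔
      HasWeakLaplacian r (mulL2 W r - -(E • b)) := by
    rw [map_neg, ← neg_add', hasWeakLaplacian_neg_iff, sub_neg_eq_add]
  change _ ↔ (HasWeakLaplacian a (mulL2 K a - E • s) ∧ HasWeakLaplacian s (mulL2 W s - E • a)) ∧
    (HasWeakLaplacian b (mulL2 K b - E • -r) ∧ HasWeakLaplacian (-r) (mulL2 W (-r) - E • b))
  rw [hneg, smul_neg]
  tauto

/-- An eigenvector for `i E` consists of two real modes, because the equations have real
coefficients. -/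
theorem mem_eigenspace_iff {d : ℕ} {V : Space d → ℝ} {f : ℝ → ℝ} {lam E : ℝ} {φ : Space d → ℝ}
    {W K : Space d →ᵇ ℝ} (hW : ∀ x, W x = lam + V x - f (φ x ^ 2))
    (hK : ∀ x, K x = lam + V x - f (φ x ^ 2) - 2 * deriv f (φ x ^ 2) * φ x ^ 2)
    (u : L2 d × L2 d) :
    u ∈ eigenspace (linearizedOperator V f lam φ) (Complex.I * E) ↔
      (reL2 u.1, imL2 u.2) ∈ realModes W K E ∧ (imL2 u.1, -reL2 u.2) ∈ realModes W K E := by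
  have hm : Lminus V f lam φ = schrodinger (d := d) W := congrArg schrodinger (funext hW).symm
  have hp : Lplus V f lam φ = schrodinger (d := d) K := congrArg schrodinger (funext hK).symm
  have key : u ∈ eigenspace (linearizedOperator V f lam φ) (Complex.I * E) ↔
      (∃ h : u.1 ∈ (schrodinger (d := d) K).domain, schrodinger (d := d) K ⟨u.1, h⟩ =
        -((Complex.I * E) • u.2)) ∧
      ∃ h : u.2 ∈ (schrodinger (d := d) W).domain, schrodinger (d := d) W ⟨u.2, h⟩ =
        (Complex.I * E) • u.1 := by
    rw [linearizedOperator, hm, hp]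
    constructor
    · rintro ⟨h, he⟩
      have h1 : schrodinger (d := d) W ⟨u.2, h.2⟩ = (Complex.I * E) • u.1 := congrArg Prod.fst he
      have h2 : -schrodinger (d := d) K ⟨u.1, h.1⟩ = (Complex.I * E) • u.2 := congrArg Prod.snd he
      exact ⟨⟨h.1, by rw [← h2, neg_neg]⟩, ⟨h.2, h1⟩⟩
    · rintro ⟨⟨h1, e1⟩, ⟨h2, e2⟩⟩
      refine ⟨⟨h1, h2⟩, Prod.ext e2 ?_⟩
      change -schrodinger (d := d) K ⟨u.1, h1⟩ = (Complex.I * E) • u.2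
      rw [e1, neg_neg]
  have hre : ∀ w : L2 d, reL2 ((Complex.I * E) • w) = -(E • imL2 w) := fun w => by
    rw [mul_smul, reL2_I_smul, imL2_smul_ofReal]
  have him : ∀ w : L2 d, imL2 ((Complex.I * E) • w) = E • reL2 w := fun w => by
    rw [mul_smul, imL2_I_smul, reL2_smul_ofReal]
  have hK' := exists_schrodinger_eq_iff K (u := u.1)
    (show reL2 (-((Complex.I * E) • u.2)) = E • imL2 u.2 by rw [map_neg, hre, neg_neg])
    (show imL2 (-((Complex.I * E) • u.2)) = -(E • reL2 u.2) by rw [map_neg, him])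
  have hW' := exists_schrodinger_eq_iff W (u := u.2) (hre u.1) (him u.1)
  exact key.trans ((and_congr hK' hW').trans (realModes_pair_iff _ _ _ _))

section Modes

variable {d : ℕ} {W K : Space d →ᵇ ℝ} {E : ℝ}

/-- The pairing `⟨ξ, η'⟩` of real modes is symmetric. -/
theorem realModes.inner_comm (hE : 0 < E) {p q : RealL2 d × RealL2 d} (hp : p ∈ realModes W K E)
    (hq : q ∈ realModes W K E) : inner ℝ p.1 q.2 = inner ℝ q.1 p.2 := by
  have h := hp.2.symm hq.2
  rw [inner_sub_left, inner_sub_right, inner_mulL2_left, real_inner_smul_left,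
    real_inner_smul_right, sub_right_inj] at h
  rw [mul_left_cancel₀ hE.ne' h, real_inner_comm]

/-- The difference of the two potentials is symmetric on real modes: by the two equations,
`⟨(W - K) ξ, η'⟩ = E (⟨ξ, ξ'⟩ - ⟨η, η'⟩)`. -/
theorem realModes.inner_coupling {P : Space d →ᵇ ℝ} (hP : ∀ x, K x = W x - 2 * P x)
    {p q : RealL2 d × RealL2 d} (hp : p ∈ realModes W K E) (hq : q ∈ realModes W K E) :
    inner ℝ (mulL2 P p.1) q.2 = inner ℝ (mulL2 P q.1) p.2 := by
  have hK : ∀ u : RealL2 d, mulL2 K u = mulL2 W u - (2 : ℝ) • mulL2 P u := fun u => by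
    ext1
    filter_upwards [coeFn_mulL2 K u, coeFn_mulL2 W u, coeFn_mulL2 P u,
      Lp.coeFn_sub (mulL2 W u) ((2 : ℝ) • mulL2 P u), Lp.coeFn_smul (2 : ℝ) (mulL2 P u)]
      with x h1 h2 h3 h4 h5
    rw [h4, Pi.sub_apply, h5, Pi.smul_apply, h1, h2, h3, hP, smul_eq_mul]
    ring
  have key : ∀ {p q : RealL2 d × RealL2 d}, p ∈ realModes W K E → q ∈ realModes W K E →
      2 * inner ℝ (mulL2 P p.1) q.2 = E * inner ℝ p.1 q.1 - E * inner ℝ p.2 q.2 := by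
    intro p q hp hq
    have h := hp.1.symm hq.2
    rw [hK, inner_sub_left, inner_sub_left, inner_sub_right, inner_mulL2_left,
      real_inner_smul_left, real_inner_smul_left, real_inner_smul_right] at h
    linarith
  have h1 := key hp hq
  have h2 := key hq hp
  rw [real_inner_comm p.1 q.1, real_inner_comm p.2 q.2] at h2
  linarith

/-- The pairing `⟨ξ, η'⟩` of real modes is positive semidefinite. -/
theorem realModes.inner_nonneg (hE : 0 < E)
    (hpos : ∀ {u g : RealL2 d}, HasWeakLaplacian u g → 0 ≤ inner ℝ u (mulL2 W u - g))
    {p : RealL2 d × RealL2 d} (hp : p ∈ realModes W K E) : 0 ≤ inner ℝ p.1 p.2 := by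
  have h := hpos hp.2
  rw [sub_sub_cancel, real_inner_smul_right, real_inner_comm] at h
  exact nonneg_of_mul_nonneg_right h hE

/-- The pairing `⟨ξ, η'⟩` of real modes is definite: if `⟨(-Δ + W) η, η⟩ = 0` then the form of the
nonnegative operator `-Δ + W` vanishes on `η` and `ξ`, so that `ξ = 0`. -/
theorem realModes.eq_zero (hE : 0 < E)
    (hpos : ∀ {u g : RealL2 d}, HasWeakLaplacian u g → 0 ≤ inner ℝ u (mulL2 W u - g))
    {p : RealL2 d × RealL2 d} (hp : p ∈ realModes W K E) (h0 : inner ℝ p.1 p.2 = 0) : p = 0 := by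
  obtain ⟨g, hg⟩ : ∃ g, HasWeakLaplacian p.1 g := ⟨_, hp.1⟩
  have hsymm := hg.symm hp.2
  rw [inner_sub_right, ← inner_mulL2_left, real_inner_smul_right] at hsymm
  -- The form of `-Δ + W` at `η + t ξ` is `2 t E ‖ξ‖² + t² c`, without constant term, and it is
  -- nonnegative for all `t`.
  have hdisc := discrim_le_zero (a := inner ℝ p.1 (mulL2 W p.1 - g))
    (b := 2 * (E * inner ℝ p.1 p.1)) (c := 0) fun t => by
      refine (hpos (hp.2.add (hg.smul t))).trans_eq ?_
      have e : mulL2 W (p.2 + t • p.1) - (mulL2 W p.2 - E • p.1 + t • g) =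
          E • p.1 + t • (mulL2 W p.1 - g) := by
        rw [map_add, map_smul, smul_sub]
        abel
      rw [e, inner_add_left, inner_add_right, inner_add_right, real_inner_smul_left,
        real_inner_smul_left, real_inner_smul_right, real_inner_smul_right, real_inner_smul_right,
        real_inner_smul_right, real_inner_comm p.1 p.2, h0, inner_sub_right p.2,
        real_inner_comm g p.2, real_inner_comm (mulL2 W p.1) p.2, hsymm]
      ring
  have h1 : p.1 = 0 := by
    have : (2 * (E * inner ℝ p.1 p.1)) ^ 2 ≤ 0 := by simpa [discrim] using hdisc
    have h2 : 2 * (E * inner ℝ p.1 p.1) = 0 := by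
      simpa using le_antisymm this (sq_nonneg _)
    simpa [hE.ne'] using h2
  have h2 : p.2 = 0 := by
    have h := hp.1.symm hp.2
    rw [h1] at h
    rw [map_zero, zero_sub, inner_neg_left, real_inner_smul_left, inner_zero_left, neg_eq_zero,
      mul_eq_zero, or_iff_right hE.ne', inner_self_eq_zero] at h
    exact h
  exact Prod.ext h1 h2

/-- The kernel of `-Δ + W` is orthogonal to `ξ`, which is in its range. -/
theorem realModes.inner_ker (hE : 0 < E) {u : RealL2 d} (hu : HasWeakLaplacian u (mulL2 W u))
    {p : RealL2 d × RealL2 d} (hp : p ∈ realModes W K E) : inner ℝ u p.1 = 0 := by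
  have h := hu.symm hp.2
  rw [inner_sub_right, inner_mulL2_left, real_inner_smul_right] at h
  have h' : E * inner ℝ u p.1 = 0 := by linarith
  exact (mul_eq_zero.mp h').resolve_left hE.ne'

/-- If `(-Δ + K) w = -u` with `u` orthogonal to `ξ`, then `w` is orthogonal to `η`. -/
theorem realModes.inner_generalized_ker (hE : 0 < E) {u w : RealL2 d}
    (hw : HasWeakLaplacian w (u + mulL2 K w)) {p : RealL2 d × RealL2 d}
    (hp : p ∈ realModes W K E) (hu : inner ℝ u p.1 = 0) : inner ℝ w p.2 = 0 := by
  have h := hw.symm hp.1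
  rw [inner_add_left, inner_sub_right, inner_mulL2_left, real_inner_smul_right, hu] at h
  have h' : E * inner ℝ w p.2 = 0 := by linarith
  exact (mul_eq_zero.mp h').resolve_left hE.ne'

end Modes

/-- A positive definite symmetric bilinear form on a finite-dimensional space has an orthonormal
basis. -/
theorem exists_basis_orthonormal {X : Type*} [AddCommGroup X] [Module ℝ X] [FiniteDimensional ℝ X]
    (B : X →ₗ[ℝ] X →ₗ[ℝ] ℝ) (hsymm : ∀ x y, B x y = B y x) (hnn : ∀ x, 0 ≤ B x x)
    (hdef : ∀ x, B x x = 0 → x = 0) :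
    ∃ (n : ℕ) (b : Module.Basis (Fin n) ℝ X), ∀ i j, B (b i) (b j) = if i = j then 1 else 0 := by
  let c : InnerProductSpace.Core ℝ X :=
    { inner := fun x y => B x y
      conj_inner_symm := fun x y => hsymm y x
      re_inner_nonneg := hnn
      add_left := fun x y z => by simp
      smul_left := fun x y r => by simp
      definite := hdef }
  let _ : NormedAddCommGroup X := c.toNormedAddCommGroup
  let _ : InnerProductSpace ℝ X := .ofCore c.toCore
  let b := stdOrthonormalBasis ℝ X
  refine ⟨_, b.toBasis, fun i j => ?_⟩
  have := orthonormal_iff_ite.mp b.orthonormal i j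
  rw [OrthonormalBasis.coe_toBasis]
  exact this

/-! ### Complexification -/

/-- The real-linear embedding `(ξ, η) ↦ (ξ, i η)`. -/
noncomputable def complexify {d : ℕ} : RealL2 d × RealL2 d →ₗ[ℝ] L2 d × L2 d where
  toFun p := (toComplex p.1, Complex.I • toComplex p.2)
  map_add' p q := by
    simp only [Prod.fst_add, Prod.snd_add, toComplex_add, smul_add, Prod.mk_add_mk]
  map_smul' c p := by
    refine Prod.ext ?_ ?_
    · change toComplex (c • p.1) = c • toComplex p.1
      rw [toComplex_smul, Complex.coe_smul]
      rfl
    · change Complex.I • toComplex (c • p.2) = c • Complex.I • toComplex p.2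
      rw [toComplex_smul, smul_comm Complex.I (c : ℂ), Complex.coe_smul]
      rfl

theorem complexify_apply {d : ℕ} (p : RealL2 d × RealL2 d) :
    complexify p = (toComplex p.1, Complex.I • toComplex p.2) := rfl

theorem complexify_injective {d : ℕ} :
    Function.Injective (complexify : RealL2 d × RealL2 d →ₗ[ℝ] L2 d × L2 d) := by
  intro p q h
  refine Prod.ext ?_ ?_
  · simpa [complexify_apply] using congrArg (fun u => reL2 u.1) h
  · simpa [complexify_apply] using congrArg (fun u => imL2 u.2) h

theorem complexify_add_I_smul {d : ℕ} (u : L2 d × L2 d) :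
    complexify (reL2 u.1, imL2 u.2) + Complex.I • complexify (imL2 u.1, -reL2 u.2) = u := by
  refine Prod.ext ?_ ?_
  · exact re_add_I_smul_im u.1
  · apply ext_re_im <;> simp [complexify_apply]

theorem inner_toComplex {d : ℕ} (a b : RealL2 d) :
    inner ℂ (toComplex a) (toComplex b) = ((inner ℝ a b : ℝ) : ℂ) := by
  rw [L2.inner_def, inner_eq_integral (u := a) (v := b) EventuallyEq.rfl EventuallyEq.rfl,
    ← integral_complex_ofReal]
  refine integral_congr_ae ?_
  filter_upwards [coeFn_toComplex a, coeFn_toComplex b] with x h1 h2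
  rw [h1, h2, RCLike.inner_apply, Complex.conj_ofReal, Complex.ofReal_mul, mul_comm]

/-- Biorthogonality implies linear independence over `ℂ`. -/
theorem linearIndependent_complexify {d n : ℕ} {p : Fin n → RealL2 d × RealL2 d}
    (h : ∀ i j, inner ℝ (p i).1 (p j).2 = if i = j then (1 : ℝ) else 0) :
    LinearIndependent ℂ fun i => complexify (p i) := by
  rw [Fintype.linearIndependent_iff]
  intro g hg j
  have h1 : ∑ i, g i • toComplex (p i).1 = 0 := by
    simpa [Prod.fst_sum, complexify_apply] using congrArg Prod.fst hg
  have h2 := congrArg (fun u => inner ℂ (toComplex (p j).2) u) h1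
  simp only [inner_sum, inner_smul_right, inner_toComplex, inner_zero_right,
    real_inner_comm (p _).1, h] at h2
  simpa [apply_ite Complex.ofReal] using h2

/-- A basis of the real modes is a complex basis of the eigenspace. -/
theorem span_complexify_eq {d n : ℕ} {R : Submodule ℝ (RealL2 d × RealL2 d)}
    {S : Submodule ℂ (L2 d × L2 d)}
    (hS : ∀ u, u ∈ S ↔ (reL2 u.1, imL2 u.2) ∈ R ∧ (imL2 u.1, -reL2 u.2) ∈ R)
    (b : Module.Basis (Fin n) ℝ R) :
    Submodule.span ℂ (range fun i => complexify (b i : RealL2 d × RealL2 d)) = S := by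
  apply le_antisymm
  · rw [Submodule.span_le]
    rintro _ ⟨i, rfl⟩
    -- The second of the two real modes of `(ξ, i η)` is zero.
    rw [SetLike.mem_coe, hS]
    have : ((0 : RealL2 d), (0 : RealL2 d)) ∈ R := R.zero_mem
    simpa [complexify_apply] using this
  · have hR : ∀ p ∈ R, complexify p ∈
        Submodule.span ℂ (range fun i => complexify (b i : RealL2 d × RealL2 d)) := by
      intro p hp
      have hsum : p = ∑ i, b.repr ⟨p, hp⟩ i • (b i : RealL2 d × RealL2 d) := by
        have := congrArg R.subtype (b.sum_repr ⟨p, hp⟩)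
        rw [map_sum] at this
        exact this.symm
      rw [hsum, map_sum]
      refine Submodule.sum_mem _ fun i _ => ?_
      rw [map_smul]
      exact Submodule.smul_of_tower_mem _ _ (Submodule.subset_span ⟨i, rfl⟩)
    intro u hu
    obtain ⟨h1, h2⟩ := (hS u).mp hu
    rw [← complexify_add_I_smul u]
    exact Submodule.add_mem _ (hR _ h1) (Submodule.smul_mem _ _ (hR _ h2))

/-- The real modes form a finite-dimensional space, as they embed into the eigenspace. -/
theorem finiteDimensional_of_complexify {d : ℕ} {R : Submodule ℝ (RealL2 d × RealL2 d)}
    {S : Submodule ℂ (L2 d × L2 d)} [FiniteDimensional ℂ S]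
    (h : ∀ p ∈ R, complexify p ∈ S) : FiniteDimensional ℝ R := by
  have : Module.Finite ℝ S := Module.Finite.trans ℂ S
  let ι : R →ₗ[ℝ] S :=
    { toFun := fun p => ⟨complexify p, h p p.2⟩
      map_add' := fun p q => Subtype.ext (map_add complexify _ _)
      map_smul' := fun c p => Subtype.ext (map_smul complexify c _) }
  exact Module.Finite.of_injective ι fun p q hpq =>
    Subtype.ext (complexify_injective (congrArg Subtype.val hpq))

end NLS

open NLS in
theorem proposition5p2 {d N : ℕ} (hd : 3 ≤ d)
    {V : NLS.Space d → ℝ} (hV : NLS.IsAdmissiblePotential V)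
    {f : ℝ → ℝ} (hf : NLS.IsAdmissibleNonlinearity f)
    {I : Set ℝ} {φ : ℝ → NLS.Space d → ℝ} (hφ : NLS.IsGroundStateBranch V f I φ)
    {lam : ℝ} (hlam : lam ∈ I) {E : ℝ} (hE : 0 < E)
    (v : Fin N → NLS.L2 d × NLS.L2 d) (hv : LinearIndependent ℂ v)
    (hspan : Submodule.span ℂ (range v) =
      NLS.eigenspace (NLS.linearizedOperator V f lam (φ lam)) (Complex.I * E)) :
    ∃ ξ η : Fin N → Lp ℝ 2 (volume : Measure (NLS.Space d)),
      LinearIndependent ℂ (fun n => (NLS.toComplex (ξ n), Complex.I • NLS.toComplex (η n))) ∧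
      Submodule.span ℂ (range fun n => (NLS.toComplex (ξ n), Complex.I • NLS.toComplex (η n))) =
        Submodule.span ℂ (range v) ∧
      (∀ m n,
        Integrable (fun x => deriv f (φ lam x ^ 2) * φ lam x ^ 2 *
          (ξ m x * η n x - ξ n x * η m x)) volume ∧
        ∫ x, deriv f (φ lam x ^ 2) * φ lam x ^ 2 * (ξ m x * η n x - ξ n x * η m x) = 0) ∧
      (∀ n, ∫ x, φ lam x * ξ n x = 0) ∧
      (∀ n, ∫ x, deriv (fun μ => φ μ x) lam * η n x = 0) ∧
      (∀ m n, ∫ x, ξ n x * η m x = if m = n then 1 else 0) := by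
  obtain ⟨W, hW⟩ := hφ.exists_potential hV hf hlam
  obtain ⟨P, hP⟩ := hφ.exists_coupling hf hlam
  obtain ⟨K, hK⟩ : ∃ K : BoundedContinuousFunction (Space d) ℝ, ∀ x, K x = W x - 2 * P x :=
    ⟨W - (2 : ℝ) • P, fun x => by simp⟩
  have hpos : ∀ {u g : RealL2 d}, HasWeakLaplacian u g → 0 ≤ inner ℝ u (mulL2 W u - g) :=
    fun h => h.schrodinger_nonneg (hφ.contDiff lam hlam) (hφ.pos lam hlam) fun x => by
      rw [hφ.laplacian_eq hlam, hW]
  have hS := mem_eigenspace_iff (E := E) hW fun x => by rw [hK, hP, hW, mul_assoc]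
  set S := eigenspace (linearizedOperator V f lam (φ lam)) (Complex.I * E)
  have : FiniteDimensional ℂ S := hspan ▸ FiniteDimensional.span_of_finite ℂ (finite_range v)
  have : FiniteDimensional ℝ (realModes W K E) := by
    refine finiteDimensional_of_complexify (S := S) fun p hp => (hS _).mpr ?_
    have h0 : ((0 : RealL2 d), (0 : RealL2 d)) ∈ realModes W K E := Submodule.zero_mem _
    simpa [complexify_apply, h0] using hp
  let B : realModes W K E →ₗ[ℝ] realModes W K E →ₗ[ℝ] ℝ :=
    LinearMap.mk₂ ℝ (fun p q => inner ℝ (p : RealL2 d × RealL2 d).1 (q : RealL2 d × RealL2 d).2)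
      (fun p q r => inner_add_left _ _ _) (fun c p q => real_inner_smul_left _ _ _)
      (fun p q r => inner_add_right _ _ _) (fun c p q => real_inner_smul_right _ _ _)
  obtain ⟨n, b, hb⟩ := exists_basis_orthonormal B (fun p q => realModes.inner_comm hE p.2 q.2)
    (fun p => realModes.inner_nonneg hE hpos p.2)
    (fun p h => Subtype.ext (realModes.eq_zero hE hpos p.2 h))
  have hort : ∀ i j, inner ℝ (b i : RealL2 d × RealL2 d).1 (b j : RealL2 d × RealL2 d).2 =
      if i = j then (1 : ℝ) else 0 := hb
  have hli := linearIndependent_complexify hort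
  have hsp := span_complexify_eq hS b
  obtain rfl : n = N := by
    have h1 := finrank_span_eq_card hli
    have h2 := finrank_span_eq_card hv
    rw [hsp] at h1
    rw [hspan] at h2
    simpa using h1.symm.trans h2
  have hstate : ∀ i, inner ℝ (hφ.state hlam) (b i : RealL2 d × RealL2 d).1 = 0 := fun i =>
    realModes.inner_ker hE (hφ.hasWeakLaplacian_state hlam hW) (b i).2
  have htangent : HasWeakLaplacian (hφ.tangent hlam)
      (hφ.state hlam + mulL2 K (hφ.tangent hlam)) :=
    hφ.hasWeakLaplacian_tangent hV hf hlam fun x => by rw [hK, hP, hW]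
  refine ⟨fun i => (b i : RealL2 d × RealL2 d).1, fun i => (b i : RealL2 d × RealL2 d).2, hli,
    hsp.trans hspan.symm, fun i j => ?_, fun i => ?_, fun i => ?_, fun i j => ?_⟩
  · have hint : ∀ u w : RealL2 d, Integrable fun x => P x * u x * w x := fun u w =>
      (memLp_mul P u).integrable_mul (Lp.memLp w)
    have hsplit : ∀ u w r s : RealL2 d,
        (fun x => deriv f (φ lam x ^ 2) * φ lam x ^ 2 * (u x * w x - r x * s x)) =
          fun x => P x * u x * w x - P x * r x * s x := fun u w r s => by
      ext x
      rw [hP]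
      ring
    rw [hsplit]
    refine ⟨(hint _ _).sub (hint _ _), ?_⟩
    rw [integral_sub (hint _ _) (hint _ _), ← inner_eq_integral (coeFn_mulL2 P _) EventuallyEq.rfl,
      ← inner_eq_integral (coeFn_mulL2 P _) EventuallyEq.rfl,
      realModes.inner_coupling hK (b i).2 (b j).2, sub_self]
  · rw [← inner_eq_integral (hφ.coeFn_state hlam) EventuallyEq.rfl, hstate]
  · rw [← inner_eq_integral (hφ.coeFn_tangent hlam) EventuallyEq.rfl,
      realModes.inner_generalized_ker hE htangent (b i).2 (hstate i)]
  · rw [← inner_eq_integral EventuallyEq.rfl EventuallyEq.rfl, hort]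
    simp only [eq_comm]
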